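/- **Theorem (optimality of Innovated Higher Criticism).** Fix $\vartheta\in(0,1)$ and $r>0$. For each $p$ let $\Omega=\Omega_p$ be a symmetric positive definite $p\times p$ real matrix with $\Omega(i,i)=1$ for all $i$, let $d_p^*(\Omega)$ be the maximum number of nonzero entries in a row of $\Omega$, and assume that $d_p^*(\Omega)\,p^{-\delta}\to 0$ as $p\to\infty$ for every fixed $\delta>0$. One observes $Y=\beta+z\in\mathbb R^p$ with $z\sim N(0,\Omega^{-1})$, and tests $H_0^{(p)}:\ \beta=0$ against $H_1^{(p)}$: $\beta$ is independent of $z$ and its coordinates are i.i.d. from $(1-\epsilon_p)\nu_0+\epsilon_p\nu_{\tau_p}$, where $\nu_a$ is the point mass at $a$, $\epsilon_p=p^{-\vartheta}$ and $\tau_p=\sqrt{2r\log p}$. Let $$\rho^*(\vartheta)=\begin{cases}0,&0<\vartheta\le 1/2,\\ \vartheta-1/2,&1/2<\vartheta\le 3/4,\\ (1-\sqrt{1-\vartheta})^2,&3/4<\vartheta<1.\end{cases}$$ For P-values $\pi_1,\dots,\pi_p$ with sorted values $\pi_{(1)}\le\dots\le\pi_{(p)}$ put $$HC(\pi_1,\dots,\pi_p)=\max_{1\le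 i\le p/2}\ \sqrt p\,\frac{i/p-\pi_{(i)}}{\sqrt{\pi_{(i)}(1-\pi_{(i)})}}.$$ For $0<\alpha<1$ let $h(p,\alpha)$ be the number with $P\{HC_p^*>h(p,\alpha)\}=\alpha$, where $HC_p^*$ is $HC$ of the one-sided P-values $\pi_i=P(N(0,1)\ge Y_i)$ and $Y\sim N(0,I_p)$. Levels $\alpha_p\in(0,1)$ with $\alpha_p\to0$ are said to tend to $0$ slowly enough if $h(p,\alpha_p)\sim\sqrt{2\log\log p}$ as $p\to\infty$. The IHC-test at level parameter $\alpha$ rejects $H_0^{(p)}$ if and only if $IHC_p^*\ge d_p^*(\Omega)\,h(p,\alpha)$, where $IHC_p^*$ is $HC$ of the two-sided P-values $\pi_i=P(|N(0,1)|\ge|(\Omega Y)_i|)$, $1\le i\le p$. 1. If $r>\rho^*(\vartheta)$ and $\alpha_p$ tends to $0$ slowly enough, then the power of the IHC-test with $\alpha=\alpha_p$, i.e. its probability of rejection under $H_1^{(p)}$, tends to $1$ as $p\to\infty$. 2. If $r<\rho^*(\vartheta)$, then for every sequence of (possibly randomized) tests of $H_0^{(p)}$ against $H_1^{(p)}$,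 the sum of the Type I and Type II error probabilities tends to $1$ as $p\to\infty$. -/

import Mathlib

open MeasureTheory ProbabilityTheory Filter Topology Matrix

noncomputable section

namespace ARW

/-- `d_p^*(Ω)`: the maximum number of nonzero entries in a row of `Ω`. -/
def maxRowNonzeros {p : ℕ} (Ω : Matrix (Fin p) (Fin p) ℝ) : ℕ :=
  Finset.univ.sup fun i => Set.ncard {j : Fin p | Ω i j ≠ 0}

/-- A sequence of precision matrices that is admissible for the Asymptotic Rare and Weak model:
each `Ω_p` is symmetric positive definite (so that `Σ_p = Ω_p⁻¹` is a covariance matrix) with unit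
diagonal, and `d_p^*(Ω_p) p^{-δ} → 0` for every fixed `δ > 0`. -/
structure IsSparsePrecision (Ω : ∀ p : ℕ, Matrix (Fin p) (Fin p) ℝ) : Prop where
  posDef : ∀ p, (Ω p).PosDef
  diag : ∀ p i, Ω p i i = 1
  sparse : ∀ δ : ℝ, 0 < δ →
    Tendsto (fun p : ℕ => (maxRowNonzeros (Ω p) : ℝ) * (p : ℝ) ^ (-δ)) atTop (𝓝 0)

/-- The fraction of signals `ε_p = p^{-ϑ}`. -/
def signalFraction (ϑ : ℝ) (p : ℕ) : ℝ := (p : ℝ) ^ (-ϑ)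

/-- The signal strength `τ_p = √(2 r log p)`. -/
def signalStrength (r : ℝ) (p : ℕ) : ℝ := √(2 * r * Real.log p)

/-- The two-point mixture `(1 - ε) ν_0 + ε ν_τ` on the real line. -/
def twoPoint (ε τ : ℝ) : Measure ℝ :=
  ENNReal.ofReal (1 - ε) • Measure.dirac 0 + ENNReal.ofReal ε • Measure.dirac τ

/-- The law of the data `Y = z`, `z ∼ N(0, Ω⁻¹)`, under the null hypothesis `β = 0`. -/
def nullLaw {p : ℕ} (Ω : Matrix (Fin p) (Fin p) ℝ) : Measure (EuclideanSpace ℝ (Fin p)) :=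
  multivariateGaussian 0 Ω⁻¹

/-- The law of the data `Y = β + z` under the alternative: the coordinates of `β` are i.i.d. from
`(1 - ε_p) ν_0 + ε_p ν_{τ_p}`, and `z ∼ N(0, Ω⁻¹)` is independent of `β`. -/
def altLaw (ϑ r : ℝ) {p : ℕ} (Ω : Matrix (Fin p) (Fin p) ℝ) :
    Measure (EuclideanSpace ℝ (Fin p)) :=
  ((Measure.pi fun _ : Fin p => twoPoint (signalFraction ϑ p) (signalStrength r p)).prod
    (multivariateGaussian 0 Ω⁻¹)).map fun x => WithLp.toLp 2 x.1 + x.2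

/-- The standard phase function for detection `ρ^*`, meant for `0 < ϑ < 1`. -/
def phaseFunction (ϑ : ℝ) : ℝ :=
  if ϑ ≤ 1 / 2 then 0
  else if ϑ ≤ 3 / 4 then ϑ - 1 / 2
  else (1 - √(1 - ϑ)) ^ 2

/-- The one-sided P-value `P(N(0,1) ≥ x)`. -/
def oneSidedPValue (x : ℝ) : ℝ := (gaussianReal 0 1).real {u | x ≤ u}

/-- The two-sided P-value `P(|N(0,1)| ≥ |x|)`. -/
def twoSidedPValue (x : ℝ) : ℝ := (gaussianReal 0 1).real {u | |x| ≤ |u|}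

/-- The Higher Criticism statistic of a vector `π` of P-values:
the maximum over `1 ≤ i ≤ p / 2` of `√p (i / p - π_(i)) / √(π_(i) (1 - π_(i)))`, where
`π_(1) ≤ ⋯ ≤ π_(p)` are the sorted P-values. The zero-based index `k` stands for `i = k + 1`. -/
def higherCriticism {p : ℕ} (π : Fin p → ℝ) : ℝ :=
  ⨆ k : {k : Fin p // 2 * ((k : ℕ) + 1) ≤ p},
    √(p : ℝ) * ((((k.1 : ℕ) : ℝ) + 1) / p - π (Tuple.sort π k.1)) /
      √(π (Tuple.sort π k.1) * (1 - π (Tuple.sort π k.1)))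

/-- The Orthodox Higher Criticism statistic `HC_p^*`: Higher Criticism of the one-sided P-values
of the coordinates of `Y`. -/
def orthodoxHC {p : ℕ} (y : EuclideanSpace ℝ (Fin p)) : ℝ :=
  higherCriticism fun i => oneSidedPValue (y i)

/-- The critical value `h(p, α)` of Orthodox Higher Criticism: the solution `t` (unique for
`p ≥ 2` and `0 < α < 1`) of `P(HC_p^* > t) = α` when `Y ∼ N(0, I_p)`. -/
def criticalValue (p : ℕ) (α : ℝ) : ℝ :=
  sInf {t : ℝ | (multivariateGaussian (0 : EuclideanSpace ℝ (Fin p)) 1).real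
    {y | t < orthodoxHC y} = α}

/-- The levels `α_p ∈ (0, 1)` tend to `0` slowly enough: `h(p, α_p) ∼ √(2 log log p)`. -/
def TendsToZeroSlowly (α : ℕ → ℝ) : Prop :=
  (∀ p, 0 < α p ∧ α p < 1) ∧ Tendsto α atTop (𝓝 0) ∧
    Asymptotics.IsEquivalent atTop (fun p : ℕ => criticalValue p (α p))
      (fun p : ℕ => √(2 * Real.log (Real.log p)))

/-- The Innovated Higher Criticism statistic `IHC_p^*`: Higher Criticism of the two-sided P-values
of the coordinates of `ΩY`. -/
def innovatedHC {p : ℕ} (Ω : Matrix (Fin p) (Fin p) ℝ) (y : EuclideanSpace ℝ (Fin p)) : ℝ :=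
  higherCriticism fun i => twoSidedPValue ((Ω *ᵥ WithLp.ofLp y) i)

/-- The rejection region `{IHC_p^* ≥ d_p^*(Ω) h(p, α)}` of the IHC test. -/
def ihcRejection {p : ℕ} (Ω : Matrix (Fin p) (Fin p) ℝ) (α : ℝ) :
    Set (EuclideanSpace ℝ (Fin p)) :=
  {y | (maxRowNonzeros Ω : ℝ) * criticalValue p α ≤ innovatedHC Ω y}

/-- The power of the IHC test: its probability of rejection under the alternative. -/
def ihcPower (ϑ r : ℝ) {p : ℕ} (Ω : Matrix (Fin p) (Fin p) ℝ) (α : ℝ) : ℝ :=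
  (altLaw ϑ r Ω).real (ihcRejection Ω α)

/-- A (possibly randomized) test: a measurable function with values in `[0, 1]`, the value at `y`
being the probability of rejecting the null hypothesis when `Y = y`. Nonrandomized tests are the
indicator functions. -/
structure IsTest {p : ℕ} (φ : EuclideanSpace ℝ (Fin p) → ℝ) : Prop where
  measurable : Measurable φ
  mem_Icc : ∀ y, φ y ∈ Set.Icc (0 : ℝ) 1

/-- The probability of rejecting a true null hypothesis. -/
def typeIError {p : ℕ} (Ω : Matrix (Fin p) (Fin p) ℝ) (φ : EuclideanSpace ℝ (Fin p) → ℝ) : ℝ :=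
  ∫ y, φ y ∂(nullLaw Ω)

/-- The probability of not rejecting the null hypothesis under the alternative. -/
def typeIIError (ϑ r : ℝ) {p : ℕ} (Ω : Matrix (Fin p) (Fin p) ℝ)
    (φ : EuclideanSpace ℝ (Fin p) → ℝ) : ℝ :=
  ∫ y, (1 - φ y) ∂(altLaw ϑ r Ω)

end ARW

end

/-!
The detection boundary is found by reducing both halves to facts about independent coordinates. The
sparsity of `Ω`, whose rows have `d = p^{o(1)}` nonzero entries, makes the price of that reduction
negligible against polynomial rates in `p`.

*Undetectability.* Colour the coordinates with `d` colours so that `Ω i j = 0` for distinct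
coordinates `i`, `j` of the same colour (`exists_coloring`), and add the signals to the noise one
colour class at a time. If `Ω` is the identity on a class `C`, then `Ω⁻¹ - 1_C` is positive
semidefinite, so `N(0, Ω⁻¹)` is the convolution of standard normal noise on `C` with another normal
law (`multivariateGaussian_inv_eq_conv`). This other law and the signals added before form an
independent noise, which cannot help a test, so each step costs at most the distance between
`N(0,1)` and its sparse mixture on at most `p` independent coordinates
(`testClose_partialLaw_union`). That distance is bounded by the second moment of the likelihood
ratio truncated at `√(2 log p)` (`testClose_pi`, `testClose_pi_twoPoint`), and it is polynomially
small when `r < ρ^*(ϑ)` (`exists_rate_testClose`). Hence `d` steps still have a total cost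
tending to zero.

*Detection.* The innovated data are `Ω Y = Ω β + w` with `w ∼ N(0, Ω)`, whose coordinates have unit
variance. Let `N` be the number of coordinates of size at least `√(2 q log p)`, and let `u` be the
null probability that a given coordinate is that large. An isolated signal keeps its full strength
`τ_p`, and no configuration of signals lowers an exceedance probability below `u`
(`exceedance_zero_le`), so the mean of `N` exceeds `p u` by nearly the contribution of the isolated
signals (`le_prod_exceedEvent`). Exceedances at `i` and `j` are independent unless the supports of
rows `i` and `j` of `Ω` meet, so the variance of `N` is at most `d²` times its mean
(`measureReal_card_le`). For `r > ρ^*(ϑ)` some `q ≤ 1` makes the excess of the mean larger than the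
standard deviation by a power of `p` (`exists_threshold`); then Higher Criticism exceeds a power of
`p` with probability tending to one (`le_altLaw_innovatedHC`), whereas the critical value
`d_p^*(Ω) h(p, α_p)` is `p^{o(1)}`.
-/

namespace ARW

/-! ### Closeness of measures for testing -/

/-- Two measures are `η`-close when every randomized test has, up to `η`, the same rejection
probability under both. For probability measures this is the bound `η` on the total variation
distance. -/
def TestClose {α : Type*} [MeasurableSpace α] (P Q : Measure α) (η : ℝ) : Prop :=
  ∀ φ : α → ℝ, Measurable φ → (∀ x, φ x ∈ Set.Icc (0 : ℝ) 1) → |∫ x, φ x ∂P - ∫ x, φ x ∂Q| ≤ η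

lemma integrable_of_mem_Icc {α : Type*} [MeasurableSpace α] {P : Measure α} [IsFiniteMeasure P]
    {φ : α → ℝ} (hφ : Measurable φ) (h : ∀ x, φ x ∈ Set.Icc (0 : ℝ) 1) : Integrable φ P :=
  Integrable.of_bound hφ.aestronglyMeasurable 1 (Eventually.of_forall fun x => by
    rw [Real.norm_eq_abs, abs_of_nonneg (h x).1]; exact (h x).2)

namespace TestClose

variable {α β : Type*} [MeasurableSpace α] [MeasurableSpace β] {P Q R : Measure α} {η η' : ℝ}

lemma refl (P : Measure α) : TestClose P P 0 := fun φ _ _ => by simp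

lemma trans (h : TestClose P Q η) (h' : TestClose Q R η') : TestClose P R (η + η') :=
  fun φ h1 h2 => (abs_sub_le _ (∫ x, φ x ∂Q) _).trans (add_le_add (h φ h1 h2) (h' φ h1 h2))

lemma map (h : TestClose P Q η) {f : α → β} (hf : Measurable f) :
    TestClose (P.map f) (Q.map f) η := fun φ h1 h2 => by
  rw [integral_map hf.aemeasurable h1.aestronglyMeasurable,
    integral_map hf.aemeasurable h1.aestronglyMeasurable]
  exact h (fun x => φ (f x)) (h1.comp hf) fun x => h2 _

lemma prod [IsProbabilityMeasure P] [IsProbabilityMeasure Q] (h : TestClose P Q η)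
    (S : Measure β) [IsProbabilityMeasure S] : TestClose (P.prod S) (Q.prod S) η :=
  fun φ h1 h2 => by
  rw [integral_prod _ (integrable_of_mem_Icc h1 h2), integral_prod _ (integrable_of_mem_Icc h1 h2)]
  refine h (fun x => ∫ y, φ (x, y) ∂S) ?_ fun x => ⟨integral_nonneg fun y => (h2 _).1, ?_⟩
  · exact (StronglyMeasurable.integral_prod_right (f := fun x y => φ (x, y))
      h1.stronglyMeasurable).measurable
  · have := integral_mono (μ := S) (f := fun y => φ (x, y)) (g := fun _ => 1)
      (integrable_of_mem_Icc (h1.comp measurable_prodMk_left) fun y => h2 _) (integrable_const _)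
      fun y => (h2 _).2
    simpa using this

/-- Adding an independent noise does not make two laws easier to tell apart. -/
lemma conv {E : Type*} [AddMonoid E] [MeasurableSpace E] [MeasurableAdd₂ E] {P Q : Measure E}
    [IsProbabilityMeasure P] [IsProbabilityMeasure Q] (h : TestClose P Q η)
    (S : Measure E) [IsProbabilityMeasure S] : TestClose (P ∗ S) (Q ∗ S) η :=
  (h.prod S).map measurable_add

/-- A one-sided bound suffices, since `1 - φ` is a test when `φ` is one. -/
lemma of_le [IsProbabilityMeasure P] [IsProbabilityMeasure Q]
    (h : ∀ φ : α → ℝ, Measurable φ → (∀ x, φ x ∈ Set.Icc (0 : ℝ) 1) →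
      ∫ x, φ x ∂P - ∫ x, φ x ∂Q ≤ η) : TestClose P Q η := fun φ h1 h2 => by
  refine abs_le.2 ⟨?_, h φ h1 h2⟩
  have := h (fun x => 1 - φ x) (by fun_prop) fun x =>
    ⟨by linarith [(h2 x).2], by linarith [(h2 x).1]⟩
  rw [integral_sub (integrable_const _) (integrable_of_mem_Icc h1 h2),
    integral_sub (integrable_const _) (integrable_of_mem_Icc h1 h2)] at this
  simp at this
  linarith

end TestClose

/-! ### The truncated likelihood ratio bound for product measures -/

lemma pi_withDensity {ι : Type*} [Fintype ι] {μ ν : ι → Measure ℝ}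
    [∀ i, IsProbabilityMeasure (μ i)] [∀ i, IsProbabilityMeasure (ν i)]
    {f : ι → ℝ → ENNReal} (hf : ∀ i, Measurable (f i)) (hν : ∀ i, ν i = (μ i).withDensity (f i)) :
    Measure.pi ν = (Measure.pi μ).withDensity fun x => ∏ i, f i (x i) := by
  refine Measure.pi_eq fun s hs => ?_
  have hind : iIndepFun (fun i (x : ι → ℝ) => (s i).indicator (f i) (x i)) (Measure.pi μ) :=
    iIndepFun_pi fun i => ((hf i).indicator (hs i)).aemeasurable
  have h1 := lintegral_prod_eq_prod_lintegral_of_indepFun Finset.univ _ hind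
    (fun i => ((hf i).indicator (hs i)).comp (measurable_pi_apply i))
  rw [withDensity_apply _ (MeasurableSet.univ_pi hs),
    ← lintegral_indicator (MeasurableSet.univ_pi hs)]
  have h2 : ∀ x : ι → ℝ, (Set.univ.pi s).indicator (fun x => ∏ i, f i (x i)) x =
      ∏ i, (s i).indicator (f i) (x i) := by
    intro x
    by_cases hx : x ∈ Set.univ.pi s
    · rw [Set.indicator_of_mem hx]
      exact Finset.prod_congr rfl fun i _ => by rw [Set.indicator_of_mem (hx i trivial)]
    · rw [Set.indicator_of_notMem hx]
      simp only [Set.mem_pi, not_forall] at hx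
      obtain ⟨i, -, hi⟩ := hx
      exact (Finset.prod_eq_zero (Finset.mem_univ i) (Set.indicator_of_notMem hi _)).symm
  simp only [h2]
  rw [h1]
  refine Finset.prod_congr rfl fun i _ => ?_
  rw [hν i, withDensity_apply _ (hs i), ← lintegral_indicator (hs i)]
  exact ((measurePreserving_eval μ i).lintegral_comp ((hf i).indicator (hs i)))

/-- The second moment bound with truncation: if the likelihood ratio `f i` of `ν i` with respect
to `μ i` dominates a function `g i` of mean at least `1 - δ` and second moment at most `1 + χ`, then
no test separates the two product measures well. -/
lemma testClose_pi {ι : Type*} [Fintype ι] {μ ν : ι → Measure ℝ}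
    [∀ i, IsProbabilityMeasure (μ i)] [∀ i, IsProbabilityMeasure (ν i)]
    {f g : ι → ℝ → ℝ} (hf : ∀ i, Measurable (f i)) (hg : ∀ i, Measurable (g i))
    (hν : ∀ i, ν i = (μ i).withDensity fun x => ENNReal.ofReal (f i x))
    (hfi : ∀ i, Integrable (f i) (μ i))
    (hg0 : ∀ i x, 0 ≤ g i x) (hgf : ∀ i x, g i x ≤ f i x)
    {δ χ : ℝ} (hδ1 : δ ≤ 1)
    (hg1 : ∀ i, 1 - δ ≤ ∫ x, g i x ∂(μ i))
    (hgi : ∀ i, Integrable (fun x => g i x ^ 2) (μ i))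
    (hg2 : ∀ i, ∫ x, g i x ^ 2 ∂(μ i) ≤ 1 + χ) :
    TestClose (Measure.pi μ) (Measure.pi ν)
      (√(Real.exp (Fintype.card ι * χ) - 1 + 2 * (Fintype.card ι * δ))) := by
  refine TestClose.of_le fun φ hφ hφ1 => ?_
  set n : ℕ := Fintype.card ι
  have hf0 : ∀ i x, 0 ≤ f i x := fun i x => (hg0 i x).trans (hgf i x)
  have hgI : ∀ i, Integrable (g i) (μ i) := fun i => by
    refine (hfi i).mono (hg i).aestronglyMeasurable (Eventually.of_forall fun x => ?_)
    rw [Real.norm_of_nonneg (hg0 i x), Real.norm_of_nonneg (hf0 i x)]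
    exact hgf i x
  set F : (ι → ℝ) → ℝ := fun x => ∏ i, f i (x i)
  set G : (ι → ℝ) → ℝ := fun x => ∏ i, g i (x i)
  have hFm : Measurable F := Finset.measurable_prod _ fun i _ => (hf i).comp (measurable_pi_apply i)
  have hGm : Measurable G := Finset.measurable_prod _ fun i _ => (hg i).comp (measurable_pi_apply i)
  have hF0 : ∀ x, 0 ≤ F x := fun x => Finset.prod_nonneg fun i _ => hf0 i _
  have hGF : ∀ x, G x ≤ F x := fun x => Finset.prod_le_prod (fun i _ => hg0 i _) fun i _ => hgf i _
  have hFI : Integrable F (Measure.pi μ) := Integrable.fintype_prod_dep hfi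
  have hGI : Integrable G (Measure.pi μ) := Integrable.fintype_prod_dep hgI
  have hG2 : ∀ x, G x ^ 2 = ∏ i, g i (x i) ^ 2 := fun x => by simp [G, Finset.prod_pow]
  have hG2I : Integrable (fun x => G x ^ 2) (Measure.pi μ) := by
    simp only [hG2]; exact Integrable.fintype_prod_dep (f := fun i x => g i x ^ 2) hgi
  have hνF : ∫ x, φ x ∂(Measure.pi ν) = ∫ x, F x * φ x ∂(Measure.pi μ) := by
    rw [pi_withDensity (fun i => (hf i).ennreal_ofReal) hν]
    have : (fun x : ι → ℝ => ∏ i, ENNReal.ofReal (f i (x i))) = fun x => ENNReal.ofReal (F x) := by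
      funext x; rw [ENNReal.ofReal_prod_of_nonneg fun i _ => hf0 i _]
    rw [this, integral_withDensity_eq_integral_toReal_smul hFm.ennreal_ofReal (by simp)]
    simp [hF0]
  have hmul : ∀ {H : (ι → ℝ) → ℝ}, Integrable H (Measure.pi μ) →
      Integrable (fun x => H x * φ x) (Measure.pi μ) := fun {H} hH =>
    hH.mul_bdd (c := 1) hφ.aestronglyMeasurable (Eventually.of_forall fun x => by
      rw [Real.norm_of_nonneg (hφ1 x).1]; exact (hφ1 x).2)
  have h1G : Integrable (fun x => 1 - G x) (Measure.pi μ) := (integrable_const _).sub hGI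
  -- the second moment of `1 - G`
  have hsq : ∫ x, (1 - G x) ^ 2 ∂(Measure.pi μ) ≤ Real.exp (n * χ) - 1 + 2 * (n * δ) := by
    have e1 : ∫ x, (1 - G x) ^ 2 ∂(Measure.pi μ) =
        1 - 2 * ∫ x, G x ∂(Measure.pi μ) + ∫ x, G x ^ 2 ∂(Measure.pi μ) := by
      have : (fun x => (1 - G x) ^ 2) = fun x => (1 - 2 * G x) + G x ^ 2 := by funext x; ring
      have h2 : Integrable (fun x => 1 - 2 * G x) (Measure.pi μ) :=
        (integrable_const _).sub (hGI.const_mul 2)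
      rw [this, integral_add h2 hG2I,
        integral_sub (integrable_const _) (hGI.const_mul 2), integral_const_mul]
      simp
    have e2 : 1 - n * δ ≤ ∫ x, G x ∂(Measure.pi μ) := by
      rw [integral_fintype_prod_eq_prod]
      calc 1 - n * δ ≤ (1 - δ) ^ n := by
            have := one_add_mul_le_pow (a := -δ) (by linarith) n
            calc 1 - n * δ = 1 + n * (-δ) := by ring
              _ ≤ _ := this
              _ = _ := by ring
        _ = ∏ _i : ι, (1 - δ) := by simp [n]
        _ ≤ _ := Finset.prod_le_prod (fun i _ => by linarith) fun i _ => hg1 i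
    have e3 : ∫ x, G x ^ 2 ∂(Measure.pi μ) ≤ Real.exp (n * χ) := by
      simp only [hG2]
      rw [integral_fintype_prod_eq_prod (f := fun i x => g i x ^ 2)]
      calc ∏ i, ∫ x, g i x ^ 2 ∂(μ i) ≤ ∏ _i : ι, Real.exp χ := by
            refine Finset.prod_le_prod (fun i _ => integral_nonneg fun x => sq_nonneg _)
              fun i _ => ?_
            linarith [hg2 i, Real.add_one_le_exp χ]
        _ = _ := by rw [Finset.prod_const, ← Real.exp_nat_mul]; rfl
    linarith
  have h1G2 : Integrable (fun x => (1 - G x) ^ 2) (Measure.pi μ) := by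
    have : (fun x => (1 - G x) ^ 2) = fun x => (1 - 2 * G x) + G x ^ 2 := by funext x; ring
    rw [this]
    exact ((integrable_const _).sub (hGI.const_mul 2)).add hG2I
  calc ∫ x, φ x ∂(Measure.pi μ) - ∫ x, φ x ∂(Measure.pi ν)
      = ∫ x, (φ x - F x * φ x) ∂(Measure.pi μ) := by
        rw [hνF, integral_sub (integrable_of_mem_Icc hφ hφ1) (hmul hFI)]
    _ ≤ ∫ x, |1 - G x| ∂(Measure.pi μ) := by
        refine integral_mono ((integrable_of_mem_Icc hφ hφ1).sub (hmul hFI)) h1G.abs fun x => ?_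
        have a := hφ1 x
        have b := hGF x
        have c := le_abs_self (1 - G x)
        have d := abs_nonneg (1 - G x)
        change φ x - F x * φ x ≤ |1 - G x|
        nlinarith [a.1, a.2, mul_nonneg a.1 (sub_nonneg.2 b), mul_nonneg a.1 (sub_nonneg.2 c),
          mul_nonneg d (sub_nonneg.2 a.2)]
    _ ≤ √(∫ x, (1 - G x) ^ 2 ∂(Measure.pi μ)) := by
        refine Real.le_sqrt_of_sq_le ?_
        -- the variance of `|1 - G|` is nonnegative
        have hM : MemLp (fun x => |1 - G x|) 2 (Measure.pi μ) := by
          refine (memLp_two_iff_integrable_sq h1G.abs.aestronglyMeasurable).2 ?_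
          simpa only [sq_abs] using h1G2
        have hv := variance_nonneg (fun x => |1 - G x|) (Measure.pi μ)
        rw [variance_eq_sub hM] at hv
        simp only [Pi.pow_apply, sq_abs] at hv
        linarith
    _ ≤ _ := Real.sqrt_le_sqrt hsq

/-! ### The normal mixture in one dimension -/

lemma integral_exp_gaussianReal (s c : ℝ) :
    ∫ x, Real.exp (s * x + c) ∂(gaussianReal 0 1) = Real.exp (s ^ 2 / 2 + c) := by
  have h : ∫ x, Real.exp (s * x) ∂(gaussianReal 0 1) = Real.exp (s ^ 2 / 2) := by
    have := congrFun (mgf_fun_id_gaussianReal (μ := 0) (v := 1)) s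
    simpa [mgf] using this
  simp only [Real.exp_add, integral_mul_const, h]

lemma integrable_exp_gaussianReal (s c : ℝ) :
    Integrable (fun x => Real.exp (s * x + c)) (gaussianReal 0 1) := by
  simp only [Real.exp_add]
  exact (integrable_exp_mul_gaussianReal s).mul_const _

lemma gaussianReal_eq_withDensity_exp (τ : ℝ) :
    gaussianReal τ 1 =
      (gaussianReal 0 1).withDensity fun x => ENNReal.ofReal (Real.exp (τ * x + -τ ^ 2 / 2)) := by
  rw [gaussianReal_of_var_ne_zero _ one_ne_zero, gaussianReal_of_var_ne_zero _ one_ne_zero,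
    ← withDensity_mul _ (measurable_gaussianPDF 0 1) (by fun_prop)]
  congr 1
  funext x
  simp only [gaussianPDF, Pi.mul_apply]
  rw [← ENNReal.ofReal_mul (gaussianPDFReal_nonneg _ _ _)]
  simp only [gaussianPDFReal, mul_assoc, ← Real.exp_add]
  congr 4
  push_cast
  ring

instance isProbabilityMeasure_twoPoint {ε τ : ℝ} [h : Fact (ε ∈ Set.Icc (0 : ℝ) 1)] :
    IsProbabilityMeasure (twoPoint ε τ) := by
  constructor
  simp only [twoPoint, Measure.coe_add, Measure.coe_smul, Pi.add_apply, Pi.smul_apply,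
    measure_univ, smul_eq_mul, mul_one]
  rw [← ENNReal.ofReal_add (by linarith [h.out.2]) h.out.1]
  simp

lemma twoPoint_conv_gaussianReal {ε τ : ℝ} (h : ε ∈ Set.Icc (0 : ℝ) 1) :
    twoPoint ε τ ∗ gaussianReal 0 1 = (gaussianReal 0 1).withDensity fun x =>
      ENNReal.ofReal ((1 - ε) + ε * Real.exp (τ * x + -τ ^ 2 / 2)) := by
  have : (fun x : ℝ => ENNReal.ofReal ((1 - ε) + ε * Real.exp (τ * x + -τ ^ 2 / 2))) =
      (fun _ => ENNReal.ofReal (1 - ε)) +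
        ENNReal.ofReal ε • fun x => ENNReal.ofReal (Real.exp (τ * x + -τ ^ 2 / 2)) := by
    funext x
    rw [ENNReal.ofReal_add (by linarith [h.2]) (mul_nonneg h.1 (Real.exp_pos _).le),
      ENNReal.ofReal_mul h.1]
    rfl
  rw [this, withDensity_add_left measurable_const, withDensity_const,
    withDensity_smul _ (by fun_prop), ← gaussianReal_eq_withDensity_exp, twoPoint,
    Measure.add_conv, Measure.conv_smul_left, Measure.conv_smul_left, Measure.dirac_conv,
    Measure.dirac_conv, gaussianReal_map_const_add, gaussianReal_map_const_add]
  simp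

/-- Testing `n` pure noise coordinates against `n` coordinates of the normal mixture with signals
`τ`, in the presence of further coordinates (those outside `C`) that carry neither noise nor signal.
The likelihood ratio of a signal is truncated at the level `t`, and both the lost mass and
the remaining second moment are bounded by Chernoff's method, the latter with parameter `s`. -/
lemma testClose_pi_twoPoint {ι : Type*} [Fintype ι] (C : Set ι) [DecidablePred (· ∈ C)]
    {ε τ t s : ℝ} (hε : ε ∈ Set.Icc (0 : ℝ) 1) (hτt : τ ≤ t) (hs : 0 ≤ s) :
    TestClose (Measure.pi fun i : ι => gaussianReal 0 (if i ∈ C then 1 else 0))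
      (Measure.pi fun i : ι => (if i ∈ C then twoPoint ε τ else Measure.dirac 0) ∗
        gaussianReal 0 (if i ∈ C then 1 else 0))
      (√(Real.exp (Fintype.card ι * (ε ^ 2 * Real.exp ((2 * τ - s) ^ 2 / 2 + (s * t - τ ^ 2)))) - 1
        + 2 * (Fintype.card ι * (ε * Real.exp (-(t - τ) ^ 2 / 2))))) := by
  classical
  have : Fact (ε ∈ Set.Icc (0 : ℝ) 1) := ⟨hε⟩
  have hprob : ∀ i : ι, IsProbabilityMeasure (if i ∈ C then twoPoint ε τ else Measure.dirac 0) :=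
    fun i => by split_ifs <;> infer_instance
  set l : ℝ → ℝ := fun x => Real.exp (τ * x + -τ ^ 2 / 2)
  set l' : ℝ → ℝ := (Set.Iic t).indicator l
  set χ := ε ^ 2 * Real.exp ((2 * τ - s) ^ 2 / 2 + (s * t - τ ^ 2))
  set δ := ε * Real.exp (-(t - τ) ^ 2 / 2)
  have hχ0 : 0 ≤ χ := by positivity
  have hδ0 : 0 ≤ δ := mul_nonneg hε.1 (Real.exp_pos _).le
  have hδ1 : δ ≤ 1 := by
    have : Real.exp (-(t - τ) ^ 2 / 2) ≤ 1 :=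
      Real.exp_le_one_iff.2 (by nlinarith [sq_nonneg (t - τ)])
    calc δ ≤ 1 * 1 := mul_le_mul hε.2 this (Real.exp_pos _).le zero_le_one
      _ = 1 := one_mul 1
  have hl0 : ∀ x, 0 ≤ l x := fun x => (Real.exp_pos _).le
  have hl'0 : ∀ x, 0 ≤ l' x := fun x => Set.indicator_nonneg (fun x _ => hl0 x) x
  have hl'l : ∀ x, l' x ≤ l x := fun x => Set.indicator_le_self' (fun x _ => hl0 x) x
  have hlm : Measurable l := by fun_prop
  have hl'm : Measurable l' := hlm.indicator measurableSet_Iic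
  have hlI : Integrable l (gaussianReal 0 1) := integrable_exp_gaussianReal _ _
  have hl'I : Integrable l' (gaussianReal 0 1) := hlI.indicator measurableSet_Iic
  have hl1 : ∫ x, l x ∂(gaussianReal 0 1) = 1 := by
    rw [integral_exp_gaussianReal, ← Real.exp_zero]; congr 1; ring
  have hl'1 : ∫ x, l' x ∂(gaussianReal 0 1) ≤ 1 := hl1 ▸ integral_mono hl'I hlI hl'l
  have hl'2 : 1 - Real.exp (-(t - τ) ^ 2 / 2) ≤ ∫ x, l' x ∂(gaussianReal 0 1) := by
    have h1 : ∀ x, l x - l' x ≤ Real.exp (t * x + (-τ ^ 2 / 2 - (t - τ) * t)) := by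
      intro x
      by_cases hx : x ≤ t
      · have : l' x = l x := Set.indicator_of_mem (s := Set.Iic t) hx l
        rw [this, sub_self]; exact (Real.exp_pos _).le
      · have : l' x = 0 := Set.indicator_of_notMem (s := Set.Iic t) hx l
        rw [this, sub_zero]
        have h0 := mul_nonneg (sub_nonneg.2 hτt) (sub_nonneg.2 (not_le.1 hx).le)
        exact Real.exp_le_exp.2 (by nlinarith)
    have h2 := integral_mono (hlI.sub hl'I) (integrable_exp_gaussianReal _ _) h1
    rw [integral_exp_gaussianReal, show t ^ 2 / 2 + (-τ ^ 2 / 2 - (t - τ) * t) =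
      -(t - τ) ^ 2 / 2 by ring] at h2
    have h3 : ∫ x, (l - l') x ∂(gaussianReal 0 1) = 1 - ∫ x, l' x ∂(gaussianReal 0 1) := by
      rw [← hl1, ← integral_sub hlI hl'I]; rfl
    linarith
  have hsq : ∀ x, l' x ^ 2 ≤ Real.exp ((2 * τ - s) * x + (s * t - τ ^ 2)) := by
    intro x
    by_cases hx : x ≤ t
    · have : l' x = l x := Set.indicator_of_mem (s := Set.Iic t) hx l
      rw [this, ← Real.exp_nat_mul]
      exact Real.exp_le_exp.2 (by push_cast; nlinarith [mul_nonneg hs (sub_nonneg.2 hx)])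
    · have : l' x = 0 := Set.indicator_of_notMem (s := Set.Iic t) hx l
      rw [this, zero_pow two_ne_zero]; exact (Real.exp_pos _).le
  have hsqI : Integrable (fun x => l' x ^ 2) (gaussianReal 0 1) := by
    refine (integrable_exp_gaussianReal (2 * τ - s) (s * t - τ ^ 2)).mono
      (hl'm.pow_const 2).aestronglyMeasurable (Eventually.of_forall fun x => ?_)
    rw [Real.norm_of_nonneg (sq_nonneg _), Real.norm_of_nonneg (Real.exp_pos _).le]
    exact hsq x
  have hsq2 : ∫ x, l' x ^ 2 ∂(gaussianReal 0 1) ≤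
      Real.exp ((2 * τ - s) ^ 2 / 2 + (s * t - τ ^ 2)) := by
    rw [← integral_exp_gaussianReal]
    exact integral_mono hsqI (integrable_exp_gaussianReal _ _) hsq
  have hexp : ∀ x, ((1 - ε) + ε * l' x) ^ 2 =
      ((1 - ε) ^ 2 + 2 * ε * (1 - ε) * l' x) + ε ^ 2 * l' x ^ 2 := fun x => by ring
  have hI1 : Integrable (fun x => (1 - ε) ^ 2 + 2 * ε * (1 - ε) * l' x) (gaussianReal 0 1) :=
    (integrable_const _).add (hl'I.const_mul _)
  refine testClose_pi
    (f := fun i x => if i ∈ C then (1 - ε) + ε * l x else 1)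
    (g := fun i x => if i ∈ C then (1 - ε) + ε * l' x else 1)
    (fun i => ?_) (fun i => ?_) (fun i => ?_) (fun i => ?_) (fun i x => ?_) (fun i x => ?_)
    hδ1 (fun i => ?_) (fun i => ?_) (fun i => ?_) <;>
  by_cases hi : i ∈ C <;> simp only [hi, if_true, if_false]
  · fun_prop
  · fun_prop
  · fun_prop
  · fun_prop
  · exact twoPoint_conv_gaussianReal hε
  · simp
  · exact (integrable_const _).add (hlI.const_mul _)
  · exact integrable_const _
  · exact add_nonneg (by linarith [hε.2]) (mul_nonneg hε.1 (hl'0 x))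
  · exact zero_le_one
  · linarith [mul_le_mul_of_nonneg_left (hl'l x) hε.1]
  · exact le_rfl
  · rw [integral_add (integrable_const _) (hl'I.const_mul _), integral_const_mul]
    simp only [integral_const, probReal_univ, one_smul]
    have := mul_le_mul_of_nonneg_left hl'2 hε.1
    simp only [δ]
    linarith
  · simp [hδ0]
  · simp only [hexp]
    exact hI1.add (hsqI.const_mul _)
  · simp
  · simp only [hexp]
    rw [integral_add hI1 (hsqI.const_mul _), integral_add (integrable_const _) (hl'I.const_mul _),
      integral_const_mul, integral_const_mul]
    simp only [integral_const, probReal_univ, one_smul]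
    have h1 := mul_le_mul_of_nonneg_left hl'1
      (mul_nonneg (mul_nonneg zero_le_two hε.1) (sub_nonneg.2 hε.2))
    have h2 := mul_le_mul_of_nonneg_left hsq2 (sq_nonneg ε)
    simp only [χ]
    nlinarith [hε.1, hε.2]
  · simp [hχ0]

/-! ### Splitting the noise along a set of uncorrelated coordinates -/

/-- The law on Euclidean space with independent coordinates of laws `μ i`. -/
noncomputable def piLaw {ι : Type*} [Fintype ι] (μ : ι → Measure ℝ) :
    Measure (EuclideanSpace ℝ ι) :=
  (Measure.pi μ).map (WithLp.toLp 2)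

section

variable {ι : Type*} [Fintype ι]

instance isProbabilityMeasure_piLaw {μ : ι → Measure ℝ} [∀ i, IsProbabilityMeasure (μ i)] :
    IsProbabilityMeasure (piLaw μ) :=
  Measure.isProbabilityMeasure_map (Measurable.aemeasurable (by fun_prop))

lemma piLaw_conv {μ ν : ι → Measure ℝ} [∀ i, IsProbabilityMeasure (μ i)]
    [∀ i, IsProbabilityMeasure (ν i)] : piLaw μ ∗ piLaw ν = piLaw fun i => μ i ∗ ν i := by
  refine Measure.ext_of_charFun (E := EuclideanSpace ℝ ι) (funext fun t => ?_)
  rw [charFun_conv, piLaw, piLaw, piLaw, charFun_pi, charFun_pi, charFun_pi,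
    ← Finset.prod_mul_distrib]
  exact Finset.prod_congr rfl fun i _ => (charFun_conv _).symm

variable [DecidableEq ι]

lemma multivariateGaussian_conv {S T : Matrix ι ι ℝ} (hS : S.PosSemidef) (hT : T.PosSemidef) :
    multivariateGaussian 0 S ∗ multivariateGaussian 0 T = multivariateGaussian 0 (S + T) := by
  refine Measure.ext_of_charFun (funext fun t => ?_)
  rw [charFun_conv, charFun_multivariateGaussian hS, charFun_multivariateGaussian hT,
    charFun_multivariateGaussian (hS.add hT), ← Complex.exp_add, add_mulVec, dotProduct_add]
  congr 1
  push_cast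
  simp only [inner_zero_right]
  push_cast
  ring

lemma multivariateGaussian_diagonal (v : ι → NNReal) :
    multivariateGaussian 0 (diagonal fun i => (v i : ℝ)) =
      piLaw fun i => gaussianReal 0 (v i) := by
  refine Measure.ext_of_charFun (E := EuclideanSpace ℝ ι) (funext fun t => ?_)
  have hd : (diagonal fun i => (v i : ℝ)).PosSemidef :=
    PosSemidef.diagonal fun i => NNReal.coe_nonneg _
  rw [charFun_multivariateGaussian hd, piLaw, charFun_pi]
  simp only [charFun_gaussianReal, ← Complex.exp_sum]
  congr 1
  simp only [inner_zero_right, dotProduct, mulVec_diagonal]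
  push_cast
  simp only [mul_zero, zero_mul, zero_sub, Finset.sum_neg_distrib, Finset.sum_div]
  congr 1
  exact Finset.sum_congr rfl fun i _ => by ring

/-- If `Ω` is the identity on a set `C` of coordinates, then the noise `N(0, Ω⁻¹)` contains
independent standard normal noise on `C` as an independent summand. -/
lemma posSemidef_inv_sub_diagonal {Ω : Matrix ι ι ℝ} (hΩ : Ω.PosDef) (C : Set ι)
    [DecidablePred (· ∈ C)] (hdiag : ∀ i, Ω i i = 1)
    (hC : ∀ i ∈ C, ∀ j ∈ C, i ≠ j → Ω i j = 0) :
    (Ω⁻¹ - diagonal fun i => if i ∈ C then (1 : ℝ) else 0).PosSemidef := by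
  refine .of_dotProduct_mulVec_nonneg
    (hΩ.inv.isHermitian.sub (isHermitian_diagonal _)) fun v => ?_
  set c : ι → ℝ := fun i => if i ∈ C then v i else 0
  set w : ι → ℝ := Ω⁻¹ *ᵥ v
  have hw : Ω *ᵥ w = v := by
    simp only [w, mulVec_mulVec]
    rw [mul_nonsing_inv _ ((isUnit_iff_isUnit_det _).1 hΩ.isUnit), one_mulVec]
  have hsymm : Ωᵀ = Ω := hΩ.isHermitian
  have hcc : c ⬝ᵥ (Ω *ᵥ c) = c ⬝ᵥ c := by
    refine Finset.sum_congr rfl fun i _ => ?_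
    by_cases hi : i ∈ C
    · congr 1
      rw [mulVec, dotProduct, Finset.sum_eq_single i, hdiag, one_mul]
      · intro j _ hj
        by_cases hjC : j ∈ C
        · rw [hC i hi j hjC hj.symm, zero_mul]
        · simp [c, hjC]
      · simp
    · simp [c, hi]
  have hcv : c ⬝ᵥ v = c ⬝ᵥ c := by
    refine Finset.sum_congr rfl fun i _ => ?_
    by_cases hi : i ∈ C <;> simp [c, hi]
  have hwc : w ⬝ᵥ (Ω *ᵥ c) = c ⬝ᵥ v := by
    rw [dotProduct_mulVec, ← mulVec_transpose, hsymm, hw, dotProduct_comm]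
  have hdv : (diagonal fun i => if i ∈ C then (1 : ℝ) else 0) *ᵥ v = c := by
    funext i
    simp [mulVec_diagonal, c]
  -- complete the square: `vᵀ Ω⁻¹ v - cᵀ c = (w - c)ᵀ Ω (w - c)`
  have h := hΩ.posSemidef.dotProduct_mulVec_nonneg (w - c)
  rw [star_trivial] at h ⊢
  rw [mulVec_sub, sub_dotProduct, dotProduct_sub, dotProduct_sub, hw, hcc, hwc, hcv] at h
  rw [sub_mulVec, hdv, dotProduct_sub, dotProduct_comm v c, hcv, dotProduct_comm v]
  change 0 ≤ w ⬝ᵥ v - _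
  linarith

lemma multivariateGaussian_inv_eq_conv {Ω : Matrix ι ι ℝ} (hΩ : Ω.PosDef) (C : Set ι)
    [DecidablePred (· ∈ C)] (hdiag : ∀ i, Ω i i = 1)
    (hC : ∀ i ∈ C, ∀ j ∈ C, i ≠ j → Ω i j = 0) :
    multivariateGaussian 0 Ω⁻¹ = (piLaw fun i => gaussianReal 0 (if i ∈ C then 1 else 0)) ∗
      multivariateGaussian 0 (Ω⁻¹ - diagonal fun i => if i ∈ C then (1 : ℝ) else 0) := by
  have h : (fun i => if i ∈ C then (1 : ℝ) else 0) =
      fun i => (((if i ∈ C then 1 else 0 : NNReal)) : ℝ) := by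
    funext i; split_ifs <;> simp
  rw [← multivariateGaussian_diagonal, ← h, multivariateGaussian_conv _
    (posSemidef_inv_sub_diagonal hΩ C hdiag hC), add_sub_cancel]
  exact PosSemidef.diagonal fun i => by dsimp only; split_ifs <;> simp

/-- The law of the data when only the coordinates in `S` may carry a signal. -/
noncomputable def partialLaw (Ω : Matrix ι ι ℝ) (ε τ : ℝ) (S : Set ι) [DecidablePred (· ∈ S)] :
    Measure (EuclideanSpace ℝ ι) :=
  (piLaw fun i => if i ∈ S then twoPoint ε τ else Measure.dirac 0) ∗ multivariateGaussian 0 Ω⁻¹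

/-- Signals on an additional set `C` of uncorrelated coordinates are as hard to detect as in the
model with independent coordinates: all other signals, and the part of the noise that is not in the
`C`-summand, act as an independent noise that is added to both laws. -/
lemma testClose_partialLaw_union {Ω : Matrix ι ι ℝ} (hΩ : Ω.PosDef) (S C T : Set ι)
    [DecidablePred (· ∈ S)] [DecidablePred (· ∈ C)] [DecidablePred (· ∈ T)]
    (hT : ∀ i, i ∈ T ↔ i ∈ S ∨ i ∈ C) (hSC : ∀ i ∈ S, i ∉ C)
    (hdiag : ∀ i, Ω i i = 1) (hC : ∀ i ∈ C, ∀ j ∈ C, i ≠ j → Ω i j = 0)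
    {ε τ η : ℝ} (hε : ε ∈ Set.Icc (0 : ℝ) 1)
    (h : TestClose (Measure.pi fun i : ι => gaussianReal 0 (if i ∈ C then 1 else 0))
      (Measure.pi fun i : ι => (if i ∈ C then twoPoint ε τ else Measure.dirac 0) ∗
        gaussianReal 0 (if i ∈ C then 1 else 0)) η) :
    TestClose (partialLaw Ω ε τ S) (partialLaw Ω ε τ T) η := by
  have : Fact (ε ∈ Set.Icc (0 : ℝ) 1) := ⟨hε⟩
  have hS : ∀ i : ι, IsProbabilityMeasure (if i ∈ S then twoPoint ε τ else Measure.dirac 0) :=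
    fun i => by split_ifs <;> infer_instance
  have hC' : ∀ i : ι, IsProbabilityMeasure (if i ∈ C then twoPoint ε τ else Measure.dirac 0) :=
    fun i => by split_ifs <;> infer_instance
  have hsplit : (piLaw fun i => if i ∈ T then twoPoint ε τ else Measure.dirac 0) =
      (piLaw fun i => if i ∈ C then twoPoint ε τ else Measure.dirac 0) ∗
        piLaw fun i => if i ∈ S then twoPoint ε τ else Measure.dirac 0 := by
    rw [piLaw_conv]
    congr 1
    funext i
    by_cases h1 : i ∈ S
    · simp [hT, h1, hSC i h1]
    · by_cases h2 : i ∈ C <;> simp [hT, h1, h2]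
  set W := multivariateGaussian (0 : EuclideanSpace ℝ ι)
    (Ω⁻¹ - diagonal fun i => if i ∈ C then (1 : ℝ) else 0)
  set R := (piLaw fun i => if i ∈ S then twoPoint ε τ else Measure.dirac 0)
  have h1 : TestClose (piLaw fun i : ι => gaussianReal 0 (if i ∈ C then 1 else 0))
      (piLaw fun i : ι => (if i ∈ C then twoPoint ε τ else Measure.dirac 0) ∗
        gaussianReal 0 (if i ∈ C then 1 else 0)) η := h.map (by fun_prop)
  have hmain := h1.conv (R ∗ W)
  rw [← piLaw_conv] at hmain
  unfold partialLaw
  rw [hsplit, multivariateGaussian_inv_eq_conv hΩ C hdiag hC]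
  convert hmain using 1
  · rw [← Measure.conv_assoc, ← Measure.conv_assoc, Measure.conv_comm R]
  · rw [Measure.conv_assoc, Measure.conv_assoc, ← Measure.conv_assoc R, Measure.conv_comm R,
      Measure.conv_assoc]

end

/-! ### Colouring the sparsity graph -/

lemma card_row_le {p : ℕ} (Ω : Matrix (Fin p) (Fin p) ℝ) (i : Fin p) :
    (Finset.univ.filter fun j => Ω i j ≠ 0).card ≤ maxRowNonzeros Ω := by
  have := Finset.le_sup (f := fun i => Set.ncard {j : Fin p | Ω i j ≠ 0}) (Finset.mem_univ i)
  refine le_trans (le_of_eq ?_) this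
  rw [← Set.ncard_coe_finset]
  simp

/-- Greedy colouring: `d_p^*(Ω)` colours suffice to give different colours to correlated
coordinates, because a row of `Ω` has a nonzero diagonal entry and at most `d_p^*(Ω) - 1` others. -/
lemma exists_coloring {p : ℕ} {Ω : Matrix (Fin p) (Fin p) ℝ} (hsymm : ∀ i j, Ω i j = Ω j i)
    (hdiag : ∀ i, Ω i i = 1) (s : Finset (Fin p)) :
    ∃ c : Fin p → ℕ, (∀ i ∈ s, c i < maxRowNonzeros Ω) ∧
      ∀ i ∈ s, ∀ j ∈ s, i ≠ j → Ω i j ≠ 0 → c i ≠ c j := by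
  induction s using Finset.induction_on with
  | empty => exact ⟨fun _ => 0, by simp, by simp⟩
  | insert a s ha ih =>
    obtain ⟨c, hc1, hc2⟩ := ih
    set N := (Finset.univ.filter fun j => Ω a j ≠ 0)
    have haN : a ∈ N := by simp [N, hdiag]
    have hlt : ((N.erase a).image c).card < (Finset.range (maxRowNonzeros Ω)).card := by
      rw [Finset.card_range]
      calc _ ≤ (N.erase a).card := Finset.card_image_le
        _ < N.card := Finset.card_erase_lt_of_mem haN
        _ ≤ _ := card_row_le Ω a
    obtain ⟨k, hk, hk'⟩ := Finset.exists_mem_notMem_of_card_lt_card hlt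
    have hne : ∀ j, j ≠ a → Ω a j ≠ 0 → k ≠ c j := by
      rintro j hja hj rfl
      exact hk' (Finset.mem_image_of_mem c (Finset.mem_erase.2 ⟨hja, by simpa [N] using hj⟩))
    refine ⟨Function.update c a k, fun i hi => ?_, fun i hi j hj hij hΩ => ?_⟩
    · by_cases h : i = a
      · subst h; simpa using hk
      · rw [Function.update_of_ne h]
        exact hc1 i ((Finset.mem_insert.1 hi).resolve_left h)
    · by_cases h : i = a
      · subst h
        rw [Function.update_self, Function.update_of_ne hij.symm]
        exact hne j hij.symm hΩ
      · by_cases h' : j = a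
        · subst h'
          rw [Function.update_self, Function.update_of_ne hij]
          exact (hne i hij (hsymm j i ▸ hΩ)).symm
        · rw [Function.update_of_ne h, Function.update_of_ne h']
          exact hc2 i ((Finset.mem_insert.1 hi).resolve_left h) j
            ((Finset.mem_insert.1 hj).resolve_left h') hij hΩ

lemma altLaw_eq_conv {ϑ r : ℝ} {p : ℕ} (Ω : Matrix (Fin p) (Fin p) ℝ)
    (hε : signalFraction ϑ p ∈ Set.Icc (0 : ℝ) 1) :
    altLaw ϑ r Ω = (piLaw fun _ : Fin p => twoPoint (signalFraction ϑ p) (signalStrength r p)) ∗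
      multivariateGaussian 0 Ω⁻¹ := by
  have : Fact (signalFraction ϑ p ∈ Set.Icc (0 : ℝ) 1) := ⟨hε⟩
  have h := Measure.map_prod_map
    (Measure.pi fun _ : Fin p => twoPoint (signalFraction ϑ p) (signalStrength r p))
    (multivariateGaussian (0 : EuclideanSpace ℝ (Fin p)) Ω⁻¹)
    (f := WithLp.toLp 2) (g := id) (by fun_prop) measurable_id
  rw [Measure.map_id] at h
  rw [altLaw, piLaw, Measure.conv, h, Measure.map_map measurable_add (by fun_prop)]
  rfl

/-- The hybrid argument: signals are added one colour class at a time. -/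
lemma testClose_nullLaw_altLaw {ϑ r : ℝ} {p : ℕ} {Ω : Matrix (Fin p) (Fin p) ℝ}
    (hΩ : Ω.PosDef) (hdiag : ∀ i, Ω i i = 1) (hε : signalFraction ϑ p ∈ Set.Icc (0 : ℝ) 1) {η : ℝ}
    (h : ∀ (C : Set (Fin p)) [DecidablePred (· ∈ C)],
      TestClose (Measure.pi fun i : Fin p => gaussianReal 0 (if i ∈ C then 1 else 0))
      (Measure.pi fun i : Fin p =>
        (if i ∈ C then twoPoint (signalFraction ϑ p) (signalStrength r p) else Measure.dirac 0) ∗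
        gaussianReal 0 (if i ∈ C then 1 else 0)) η) :
    TestClose (nullLaw Ω) (altLaw ϑ r Ω) (maxRowNonzeros Ω * η) := by
  have hsymm : ∀ i j, Ω i j = Ω j i := fun i j => by
    have := congrFun (congrFun hΩ.isHermitian j) i
    simpa using this
  obtain ⟨c, hc1, hc2⟩ := exists_coloring hsymm hdiag Finset.univ
  have hstep : ∀ m : ℕ, TestClose (nullLaw Ω)
      (partialLaw Ω (signalFraction ϑ p) (signalStrength r p) {i | c i < m}) (m * η) := by
    intro m
    induction m with
    | zero =>
      have hdirac : (piLaw fun _ : Fin p => Measure.dirac (0 : ℝ)) = Measure.dirac 0 := by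
        refine Measure.ext_of_charFun (E := EuclideanSpace ℝ (Fin p)) (funext fun t => ?_)
        rw [piLaw, charFun_pi]
        simp [charFun_dirac]
      have h0 : partialLaw Ω (signalFraction ϑ p) (signalStrength r p) {i | c i < 0} =
          nullLaw Ω := by
        simp only [partialLaw, Set.mem_ofPred_eq, not_lt_zero, if_false, hdirac]
        rw [Measure.dirac_zero_conv]
        rfl
      rw [h0]
      simpa using TestClose.refl (nullLaw Ω)
    | succ m ih =>
      have h1 := testClose_partialLaw_union hΩ {i | c i < m} {i | c i = m} {i | c i < m + 1}
        (fun i => by simp only [Set.mem_ofPred_eq]; omega)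
        (fun i hi => by simp only [Set.mem_ofPred_eq] at hi ⊢; omega) hdiag
        (fun i hi j hj hij => by
          by_contra hne
          exact hc2 i (Finset.mem_univ i) j (Finset.mem_univ j) hij hne (hi.trans hj.symm)) hε
        (h {i | c i = m})
      have h2 := ih.trans h1
      push_cast
      rwa [add_mul, one_mul]
  have hfull := hstep (maxRowNonzeros Ω)
  have : partialLaw Ω (signalFraction ϑ p) (signalStrength r p) {i | c i < maxRowNonzeros Ω} =
      altLaw ϑ r Ω := by
    rw [altLaw_eq_conv Ω hε, partialLaw]
    congr 2
    funext i
    exact if_pos (hc1 i (Finset.mem_univ i))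
  rwa [this] at hfull

/-! ### The undetectable region -/

lemma signalFraction_eq_exp (ϑ : ℝ) {p : ℕ} (hp : 2 ≤ p) :
    signalFraction ϑ p = Real.exp (-ϑ * Real.log p) := by
  rw [signalFraction, Real.rpow_def_of_pos (by positivity), mul_comm]

lemma signalFraction_mem_Icc {ϑ : ℝ} (hϑ : 0 < ϑ) {p : ℕ} (hp : 2 ≤ p) :
    signalFraction ϑ p ∈ Set.Icc (0 : ℝ) 1 := by
  rw [signalFraction_eq_exp ϑ hp]
  refine ⟨(Real.exp_pos _).le, Real.exp_le_one_iff.2 ?_⟩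
  have : 0 ≤ Real.log p := Real.log_natCast_nonneg p
  nlinarith

lemma signalStrength_eq {r : ℝ} (hr : 0 ≤ r) (p : ℕ) :
    signalStrength r p = √r * √(2 * Real.log p) := by
  rw [signalStrength, mul_comm 2 r, mul_assoc, Real.sqrt_mul hr]

lemma isProbabilityMeasure_altLaw {ϑ : ℝ} (r : ℝ) {p : ℕ} (Ω : Matrix (Fin p) (Fin p) ℝ)
    (hε : signalFraction ϑ p ∈ Set.Icc (0 : ℝ) 1) : IsProbabilityMeasure (altLaw ϑ r Ω) := by
  have : Fact (signalFraction ϑ p ∈ Set.Icc (0 : ℝ) 1) := ⟨hε⟩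
  exact Measure.isProbabilityMeasure_map (Measurable.aemeasurable (by fun_prop))

lemma phaseFunction_lower {ϑ r : ℝ} (hϑ1 : ϑ < 1) (hr : 0 < r) (h : r < phaseFunction ϑ) :
    1 - ϑ < (1 - √r) ^ 2 ∧ √r < 1 ∧ (r ≤ 1 / 4 → 1 - 2 * ϑ + 2 * r < 0) := by
  set s := √(1 - ϑ)
  have hs0 : 0 ≤ s := Real.sqrt_nonneg _
  have hs : s ^ 2 = 1 - ϑ := Real.sq_sqrt (by linarith)
  have hϑ : 1 / 2 < ϑ := by
    by_contra hle
    rw [phaseFunction, if_pos (not_lt.1 hle)] at h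
    linarith
  have hs1 : s < 1 := by nlinarith
  -- the parabola branch lies on or above the detection boundary on all of `(1/2, 1)`
  have key : r < (1 - s) ^ 2 ∧ (r ≤ 1 / 4 → 1 - 2 * ϑ + 2 * r < 0) := by
    rw [phaseFunction, if_neg (not_le.2 hϑ)] at h
    split_ifs at h with h34
    · exact ⟨by nlinarith [sq_nonneg (s - 1 / 2)], fun _ => by linarith⟩
    · exact ⟨h, fun _ => by linarith⟩
  have hsr : √r < 1 - s := by
    rw [Real.sqrt_lt' (by linarith)]
    exact key.1
  refine ⟨?_, by linarith, key.2⟩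
  rw [← hs]
  exact pow_lt_pow_left₀ (by linarith) hs0 two_ne_zero

/-- Below the detection boundary the independent model is undetectable at a polynomial rate, even if
only a subset `C` of the coordinates is observed. -/
lemma exists_rate_testClose {ϑ r : ℝ} (hϑ0 : 0 < ϑ) (hϑ1 : ϑ < 1) (hr : 0 < r)
    (h : r < phaseFunction ϑ) :
    ∃ κ : ℝ, 0 < κ ∧ ∀ p : ℕ, 2 ≤ p → ∀ (C : Set (Fin p)) [DecidablePred (· ∈ C)],
      TestClose (Measure.pi fun i : Fin p => gaussianReal 0 (if i ∈ C then 1 else 0))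
      (Measure.pi fun i : Fin p =>
        (if i ∈ C then twoPoint (signalFraction ϑ p) (signalStrength r p) else Measure.dirac 0) ∗
        gaussianReal 0 (if i ∈ C then 1 else 0)) (2 * (p : ℝ) ^ (-κ)) := by
  obtain ⟨h1, h2, h3⟩ := phaseFunction_lower hϑ1 hr h
  have hr2 : √r ^ 2 = r := Real.sq_sqrt hr.le
  -- a common exponent for the truncated mass and the truncated second moment
  obtain ⟨κ, hκ, hκ1, hκ2⟩ : ∃ κ : ℝ, 0 < κ ∧ 2 * κ ≤ (1 - √r) ^ 2 - (1 - ϑ) ∧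
      (r ≤ 1 / 4 → 2 * κ ≤ -(1 - 2 * ϑ + 2 * r)) := by
    by_cases hr4 : r ≤ 1 / 4
    · refine ⟨min ((1 - √r) ^ 2 - (1 - ϑ)) (-(1 - 2 * ϑ + 2 * r)) / 2, ?_, ?_, fun _ => ?_⟩
      · exact half_pos (lt_min (by linarith) (by linarith [h3 hr4]))
      · linarith [min_le_left ((1 - √r) ^ 2 - (1 - ϑ)) (-(1 - 2 * ϑ + 2 * r))]
      · linarith [min_le_right ((1 - √r) ^ 2 - (1 - ϑ)) (-(1 - 2 * ϑ + 2 * r))]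
    · exact ⟨((1 - √r) ^ 2 - (1 - ϑ)) / 2, by linarith, by linarith, fun h => absurd h hr4⟩
  refine ⟨κ, hκ, fun p hp C _ => ?_⟩
  set L := Real.log p
  have hL : 0 ≤ L := Real.log_natCast_nonneg p
  have hp0 : (0 : ℝ) < p := by positivity
  have hpL : (p : ℝ) = Real.exp L := (Real.exp_log hp0).symm
  set t := √(2 * L)
  have ht0 : 0 ≤ t := Real.sqrt_nonneg _
  have ht2 : t ^ 2 = 2 * L := Real.sq_sqrt (by positivity)
  have hτ : signalStrength r p = √r * t := signalStrength_eq hr.le p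
  have hτt : signalStrength r p ≤ t := by rw [hτ]; nlinarith
  have hε := signalFraction_mem_Icc hϑ0 hp
  set x := Real.exp (-(2 * κ) * L)
  have hx0 : 0 < x := Real.exp_pos _
  have hx1 : x ≤ 1 := Real.exp_le_one_iff.2 (by nlinarith)
  have hδ : p * (signalFraction ϑ p * Real.exp (-(t - signalStrength r p) ^ 2 / 2)) ≤ x := by
    rw [signalFraction_eq_exp ϑ hp, hpL, Real.log_exp, ← Real.exp_add, ← Real.exp_add,
      Real.exp_le_exp, hτ]
    have : (t - √r * t) ^ 2 = (1 - √r) ^ 2 * (2 * L) := by rw [← ht2]; ring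
    rw [this]
    linarith [mul_le_mul_of_nonneg_right hκ1 hL]
  obtain ⟨s, hs, hχ⟩ : ∃ s : ℝ, 0 ≤ s ∧ p * (signalFraction ϑ p ^ 2 *
      Real.exp ((2 * signalStrength r p - s) ^ 2 / 2 + (s * t - signalStrength r p ^ 2))) ≤ x := by
    have hτ2 : signalStrength r p ^ 2 = r * (2 * L) := by rw [hτ, mul_pow, hr2, ht2]
    by_cases hr4 : r ≤ 1 / 4
    -- no truncation is needed for weak signals
    · refine ⟨0, le_rfl, ?_⟩
      rw [signalFraction_eq_exp ϑ hp, hpL, Real.log_exp, ← Real.exp_nat_mul, ← Real.exp_add,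
        ← Real.exp_add, Real.exp_le_exp]
      have := hκ2 hr4
      push_cast
      linarith [mul_le_mul_of_nonneg_right this hL]
    -- otherwise the tilted mean `2τ` exceeds `t`, and Chernoff's method tilts it back to `t`
    · have hr12 : 1 / 2 ≤ √r := Real.le_sqrt_of_sq_le (by linarith [not_le.1 hr4])
      refine ⟨2 * signalStrength r p - t, by rw [hτ]; nlinarith, ?_⟩
      rw [signalFraction_eq_exp ϑ hp, hpL, Real.log_exp, ← Real.exp_nat_mul, ← Real.exp_add,
        ← Real.exp_add, Real.exp_le_exp]
      have e : (2 * signalStrength r p - (2 * signalStrength r p - t)) ^ 2 / 2 +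
          ((2 * signalStrength r p - t) * t - signalStrength r p ^ 2) =
          L * (4 * √r - 2 * r - 1) := by
        rw [hτ2, hτ]
        linear_combination (2 * √r - 1 / 2) * ht2
      rw [e]
      push_cast
      have h4 : 2 * κ ≤ 2 * ϑ - 4 * √r + 2 * r := by linarith [hr2, sq_nonneg (1 - √r)]
      linarith [mul_le_mul_of_nonneg_right h4 hL]
  have hmain := testClose_pi_twoPoint C hε hτt hs
  rw [Fintype.card_fin] at hmain
  have hbound : √(Real.exp (p * (signalFraction ϑ p ^ 2 *
      Real.exp ((2 * signalStrength r p - s) ^ 2 / 2 + (s * t - signalStrength r p ^ 2)))) - 1 +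
      2 * (p * (signalFraction ϑ p * Real.exp (-(t - signalStrength r p) ^ 2 / 2)))) ≤
      2 * (p : ℝ) ^ (-κ) := by
    refine Real.sqrt_le_iff.2 ⟨by positivity, ?_⟩
    have e1 : ((p : ℝ) ^ (-κ)) ^ 2 = x := by
      rw [Real.rpow_def_of_pos hp0, ← Real.exp_nat_mul]
      simp only [x]
      congr 1
      push_cast
      ring
    have e2 := Real.abs_exp_sub_one_le (x := x) (by rwa [abs_of_pos hx0])
    rw [abs_of_pos hx0] at e2
    have e3 := le_abs_self (Real.exp x - 1)
    have e4 := Real.exp_le_exp.2 hχ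
    rw [mul_pow, e1]
    linarith
  exact fun φ hφ hφ1 => (hmain φ hφ hφ1).trans hbound

theorem tendsto_typeIError_add_typeIIError {ϑ r : ℝ} (hϑ0 : 0 < ϑ) (hϑ1 : ϑ < 1) (hr : 0 < r)
    {Ω : ∀ p : ℕ, Matrix (Fin p) (Fin p) ℝ} (hΩ : IsSparsePrecision Ω)
    (h : r < phaseFunction ϑ) {φ : ∀ p : ℕ, EuclideanSpace ℝ (Fin p) → ℝ}
    (hφ : ∀ p, IsTest (φ p)) :
    Tendsto (fun p : ℕ => typeIError (Ω p) (φ p) + typeIIError ϑ r (Ω p) (φ p)) atTop (𝓝 1) := by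
  obtain ⟨κ, hκ, hrate⟩ := exists_rate_testClose hϑ0 hϑ1 hr h
  have hlim : Tendsto (fun p : ℕ => (maxRowNonzeros (Ω p) : ℝ) * (2 * (p : ℝ) ^ (-κ)))
      atTop (𝓝 0) := by
    have := (hΩ.sparse κ hκ).const_mul 2
    rw [mul_zero] at this
    refine this.congr fun p => by ring
  rw [tendsto_iff_norm_sub_tendsto_zero]
  refine squeeze_zero' (Eventually.of_forall fun p => norm_nonneg _) ?_ hlim
  filter_upwards [eventually_ge_atTop 2] with p hp
  have hε := signalFraction_mem_Icc hϑ0 hp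
  have := isProbabilityMeasure_altLaw r (Ω p) hε
  have hclose := testClose_nullLaw_altLaw (r := r) (hΩ.posDef p) (hΩ.diag p) hε (hrate p hp)
    (φ p) (hφ p).measurable (hφ p).mem_Icc
  have e : typeIError (Ω p) (φ p) + typeIIError ϑ r (Ω p) (φ p) - 1 =
      ∫ y, φ p y ∂(nullLaw (Ω p)) - ∫ y, φ p y ∂(altLaw ϑ r (Ω p)) := by
    rw [typeIError, typeIIError, integral_sub (integrable_const _)
      (integrable_of_mem_Icc (hφ p).measurable (hφ p).mem_Icc)]
    simp
    ring
  rw [e, Real.norm_eq_abs]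
  exact hclose

/-! ### Higher Criticism at a fixed threshold -/

/-- Higher Criticism is at least as large as the normalized exceedance at any threshold `u` that is
reached by at least `k` of the P-values. -/
lemma le_higherCriticism {p : ℕ} {π : Fin p → ℝ} (hπ : ∀ i, 0 < π i) {u : ℝ} (hu : u < 1)
    {k : ℕ} (hk : 1 ≤ k) (hkp : 2 * k ≤ p) (hcard : k ≤ (Finset.univ.filter fun i => π i ≤ u).card)
    (huk : u ≤ k / p) : √(p : ℝ) * (k / p - u) / √u ≤ higherCriticism π := by
  have hlt : k - 1 < p := by omega
  set v := π (Tuple.sort π ⟨k - 1, hlt⟩)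
  have hv0 : 0 < v := hπ _
  -- otherwise only the first `k - 1` order statistics could be at most `u`
  have hvu : v ≤ u := by
    by_contra hvu
    have hsub : (Finset.univ.filter fun i => π i ≤ u) ⊆
        (Finset.univ.filter fun j : Fin p => (j : ℕ) < k - 1).image (Tuple.sort π) := by
      intro i hi
      rw [Finset.mem_filter] at hi
      refine Finset.mem_image.2 ⟨(Tuple.sort π).symm i, ?_, by simp⟩
      rw [Finset.mem_filter]
      refine ⟨Finset.mem_univ _, ?_⟩
      by_contra hge
      have hmono := Tuple.monotone_sort π
        (show (⟨k - 1, hlt⟩ : Fin p) ≤ (Tuple.sort π).symm i from not_lt.1 hge)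
      simp only [Function.comp_apply, Equiv.apply_symm_apply] at hmono
      exact hvu (hmono.trans hi.2)
    have h1 := Finset.card_le_card hsub
    have h2 : ((Finset.univ.filter fun j : Fin p => (j : ℕ) < k - 1).image (Tuple.sort π)).card ≤
        k - 1 := by
      refine Finset.card_image_le.trans ?_
      rw [← Finset.card_range (k - 1), ← Finset.card_map Fin.valEmbedding]
      refine Finset.card_le_card fun j hj => ?_
      obtain ⟨a, ha, rfl⟩ := Finset.mem_map.1 hj
      simpa using ha
    omega
  have hv1 : v < 1 := hvu.trans_lt hu
  have hprod : 0 < v * (1 - v) := mul_pos hv0 (by linarith)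
  have hle : v * (1 - v) ≤ u := by nlinarith
  have hterm := le_ciSup (f := fun k : {k : Fin p // 2 * ((k : ℕ) + 1) ≤ p} =>
    √(p : ℝ) * ((((k.1 : ℕ) : ℝ) + 1) / p - π (Tuple.sort π k.1)) /
      √(π (Tuple.sort π k.1) * (1 - π (Tuple.sort π k.1)))) (Set.finite_range _).bddAbove
    ⟨⟨k - 1, hlt⟩, by simp only; omega⟩
  refine le_trans ?_ hterm
  have hcast : ((k - 1 : ℕ) : ℝ) + 1 = k := by
    rw [Nat.cast_sub hk]; simp
  simp only [hcast]
  change _ ≤ √(p : ℝ) * (k / p - v) / √(v * (1 - v))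
  refine div_le_div₀ (mul_nonneg (Real.sqrt_nonneg _) (by linarith)) ?_ (Real.sqrt_pos.2 hprod)
    (Real.sqrt_le_sqrt hle)
  exact mul_le_mul_of_nonneg_left (by linarith) (Real.sqrt_nonneg _)

/-! ### Exceedance probabilities of a shifted normal variable -/

/-- The probability that a normal variable with mean `m` and variance `1` is at least `t` in
absolute value. -/
noncomputable def exceedance (t m : ℝ) : ENNReal := gaussianReal 0 1 {x | t ≤ |m + x|}

lemma measurableSet_exceedance (t m : ℝ) : MeasurableSet {x : ℝ | t ≤ |m + x|} :=
  measurableSet_le measurable_const (by fun_prop)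

lemma measurable_exceedance (t : ℝ) : Measurable (exceedance t) :=
  measurable_measure_prodMk_left (ν := gaussianReal 0 1)
    (s := {q : ℝ × ℝ | t ≤ |q.1 + q.2|}) (measurableSet_le measurable_const (by fun_prop))

lemma exceedance_le_one (t m : ℝ) : exceedance t m ≤ 1 := prob_le_one

lemma exceedance_ne_top (t m : ℝ) : exceedance t m ≠ ⊤ := measure_ne_top _ _

lemma exceedance_zero (t : ℝ) (ht : 0 ≤ t) : (exceedance t 0).toReal = twoSidedPValue t := by
  simp [exceedance, twoSidedPValue, measureReal_def, abs_of_nonneg ht]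

lemma exceedance_neg (t m : ℝ) : exceedance t (-m) = exceedance t m := by
  have h := gaussianReal_map_neg (μ := 0) (v := 1)
  rw [neg_zero] at h
  rw [exceedance, ← h, Measure.map_apply measurable_neg (measurableSet_exceedance t _), exceedance]
  congr 1
  ext x
  simp only [Set.preimage_ofPred_eq, Set.mem_ofPred_eq]
  rw [← abs_neg, neg_add, neg_neg, neg_neg]

lemma measureReal_Ioc_gaussianReal {a b : ℝ} (hab : a ≤ b) :
    (gaussianReal 0 1).real (Set.Ioc a b) = ∫ x in a..b, gaussianPDFReal 0 1 x := by
  rw [measureReal_def, gaussianReal_apply_eq_integral _ one_ne_zero,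
    intervalIntegral.integral_of_le hab, ENNReal.toReal_ofReal]
  exact setIntegral_nonneg measurableSet_Ioc fun x _ => gaussianPDFReal_nonneg _ _ _

lemma gaussianPDFReal_le_of_abs_le {x y : ℝ} (h : |y| ≤ |x|) :
    gaussianPDFReal 0 1 x ≤ gaussianPDFReal 0 1 y := by
  have := sq_le_sq.2 h
  simp only [gaussianPDFReal]
  refine mul_le_mul_of_nonneg_left (Real.exp_le_exp.2 ?_) (by positivity)
  simp only [sub_zero, NNReal.coe_one, mul_one]
  linarith

/-- Shifting a normal variable away from the origin makes large absolute values more likely. -/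
lemma exceedance_zero_le {t : ℝ} (ht : 0 ≤ t) (m : ℝ) : exceedance t 0 ≤ exceedance t m := by
  wlog hm : 0 ≤ m generalizing m
  · rw [← exceedance_neg t m]
    exact this (-m) (by linarith)
  have hI : ∀ a b, IntervalIntegrable (gaussianPDFReal 0 1) volume a b := fun a b =>
    (integrable_gaussianPDFReal 0 1).intervalIntegrable
  -- the interval `(-t-m, -t)` that is gained and the interval `(t-m, t)` that is lost
  -- are translates of each other, and the latter is closer to the origin
  have key : (gaussianReal 0 1).real (Set.Ioc (-t - m) (t - m)) ≤
      (gaussianReal 0 1).real (Set.Ioc (-t) t) := by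
    rw [measureReal_Ioc_gaussianReal (by linarith), measureReal_Ioc_gaussianReal (by linarith)]
    have e1 := intervalIntegral.integral_add_adjacent_intervals (hI (-t - m) (-t)) (hI (-t) (t - m))
    have e2 := intervalIntegral.integral_add_adjacent_intervals (hI (-t) (t - m)) (hI (t - m) t)
    have e3 : ∫ x in (-t - m)..(-t), gaussianPDFReal 0 1 (x + 2 * t) =
        ∫ x in (t - m)..t, gaussianPDFReal 0 1 x := by
      rw [intervalIntegral.integral_comp_add_right]
      congr 1 <;> ring
    have e4 : ∫ x in (-t - m)..(-t), gaussianPDFReal 0 1 x ≤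
        ∫ x in (-t - m)..(-t), gaussianPDFReal 0 1 (x + 2 * t) := by
      refine intervalIntegral.integral_mono_on (by linarith) (hI _ _)
        ((integrable_gaussianPDFReal 0 1).comp_add_right (2 * t)).intervalIntegrable fun x hx => ?_
      refine gaussianPDFReal_le_of_abs_le ?_
      have hx2 := hx.2
      rw [abs_of_nonpos (by linarith : x ≤ 0)]
      exact abs_le.2 ⟨by linarith, by linarith⟩
    linarith
  have hcompl : ∀ m' : ℝ, (exceedance t m').toReal =
      1 - (gaussianReal 0 1).real (Set.Ioc (-t - m') (t - m')) := by
    intro m'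
    have hna : NullSingletonClass (gaussianReal 0 1) :=
      nullSingletonClass_gaussianReal one_ne_zero
    have h1 : (gaussianReal 0 1).real (Set.Ioc (-t - m') (t - m')) =
        (gaussianReal 0 1).real (Set.Ioo (-t - m') (t - m')) :=
      measureReal_congr Ioo_ae_eq_Ioc.symm
    rw [h1, ← probReal_compl_eq_one_sub measurableSet_Ioo, exceedance, measureReal_def]
    congr 2
    ext x
    simp only [Set.mem_ofPred_eq, Set.mem_compl_iff, Set.mem_Ioo, not_and_or, not_lt, le_abs]
    constructor
    · rintro (h | h)
      · right; linarith
      · left; linarith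
    · rintro (h | h)
      · right; linarith
      · left; linarith
  rw [← ENNReal.toReal_le_toReal (exceedance_ne_top _ _) (exceedance_ne_top _ _),
    hcompl, hcompl]
  simp only [sub_zero]
  linarith

lemma exp_le_measureReal_Ici {s : ℝ} (hs : 0 ≤ s) :
    (√(2 * Real.pi))⁻¹ * Real.exp (-(s + 1) ^ 2 / 2) ≤ (gaussianReal 0 1).real (Set.Ici s) := by
  have h1 : (gaussianReal 0 1).real (Set.Ioc s (s + 1)) ≤ (gaussianReal 0 1).real (Set.Ici s) :=
    measureReal_mono fun x hx => hx.1.le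
  refine le_trans ?_ h1
  rw [measureReal_Ioc_gaussianReal (by linarith)]
  have h2 : ∫ _x in s..(s + 1), gaussianPDFReal 0 1 (s + 1) ≤
      ∫ x in s..(s + 1), gaussianPDFReal 0 1 x := by
    refine intervalIntegral.integral_mono_on (by linarith) intervalIntegrable_const
      (integrable_gaussianPDFReal 0 1).intervalIntegrable fun x hx => ?_
    refine gaussianPDFReal_le_of_abs_le ?_
    rw [abs_of_nonneg (hs.trans hx.1), abs_of_nonneg (by linarith)]
    exact hx.2
  refine le_trans (le_of_eq ?_) h2
  simp [gaussianPDFReal]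

lemma exp_le_exceedance {t m s : ℝ} (hs : 0 ≤ s) (hts : t - m ≤ s) :
    (√(2 * Real.pi))⁻¹ * Real.exp (-(s + 1) ^ 2 / 2) ≤ (exceedance t m).toReal := by
  refine (exp_le_measureReal_Ici hs).trans (measureReal_mono fun x hx => ?_)
  have hx' : s ≤ x := hx
  have h : t ≤ m + x := by linarith
  exact h.trans (le_abs_self _)

lemma twoSidedPValue_pos (x : ℝ) : 0 < twoSidedPValue x := by
  have h1 : (gaussianReal 0 1).real (Set.Ici |x|) ≤ twoSidedPValue x :=
    measureReal_mono fun y hy => le_trans hy (le_abs_self y)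
  refine lt_of_lt_of_le ?_ ((exp_le_measureReal_Ici (abs_nonneg x)).trans h1)
  positivity

lemma twoSidedPValue_anti {x y : ℝ} (h : |x| ≤ |y|) : twoSidedPValue y ≤ twoSidedPValue x :=
  measureReal_mono fun _ hz => h.trans hz

lemma twoSidedPValue_le {t : ℝ} (ht : 0 ≤ t) : twoSidedPValue t ≤ 2 * Real.exp (-t ^ 2 / 2) := by
  have hS : MeasurableSet {x : ℝ | |t| ≤ |x|} := measurableSet_le measurable_const (by fun_prop)
  have hI := (integrable_exp_gaussianReal t (-t ^ 2)).add
    (integrable_exp_gaussianReal (-t) (-t ^ 2))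
  have h : ∫ x, {x : ℝ | |t| ≤ |x|}.indicator 1 x ∂(gaussianReal 0 1) ≤
      ∫ x, (Real.exp (t * x + -t ^ 2) + Real.exp (-t * x + -t ^ 2)) ∂(gaussianReal 0 1) := by
    refine integral_mono ((integrable_const 1).indicator hS) hI fun x => ?_
    have p1 := Real.exp_pos (t * x + -t ^ 2)
    have p2 := Real.exp_pos (-t * x + -t ^ 2)
    by_cases hx : |t| ≤ |x|
    · rw [Set.indicator_of_mem (show x ∈ {x : ℝ | |t| ≤ |x|} from hx)]
      simp only [Pi.one_apply]
      rw [abs_of_nonneg ht, le_abs] at hx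
      rcases hx with hx | hx
      · have := Real.one_le_exp (x := t * x + -t ^ 2) (by nlinarith)
        linarith
      · have := Real.one_le_exp (x := -t * x + -t ^ 2) (by nlinarith)
        linarith
    · rw [Set.indicator_of_notMem (show x ∉ {x : ℝ | |t| ≤ |x|} from hx)]
      positivity
  rw [integral_indicator_one hS, integral_add (integrable_exp_gaussianReal _ _)
    (integrable_exp_gaussianReal _ _), integral_exp_gaussianReal, integral_exp_gaussianReal] at h
  refine h.trans (le_of_eq ?_)
  rw [two_mul]
  congr 2 <;> ring

/-! ### Counting weakly dependent events -/

open Classical in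
/-- Chebyshev's inequality for the number of events that occur, when each event is independent of
all but at most `D` of them. -/
lemma measureReal_card_le {α ι : Type*} [MeasurableSpace α] [Fintype ι] (P : Measure α)
    [IsProbabilityMeasure P] {A : ι → Set α} (hA : ∀ i, MeasurableSet (A i)) {D : ℕ}
    (hD : ∀ i, (Finset.univ.filter fun j => P.real (A i ∩ A j) ≠ P.real (A i) * P.real (A j)).card
      ≤ D) {c : ℝ} (hc : 0 < c) :
    P.real {ω | ((Finset.univ.filter fun i => ω ∈ A i).card : ℝ) ≤ (∑ i, P.real (A i)) - c} ≤
      D * (∑ i, P.real (A i)) / c ^ 2 := by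
  set N : α → ℝ := fun ω => ∑ i, (A i).indicator 1 ω
  have hI : ∀ i, Integrable ((A i).indicator (1 : α → ℝ)) P := fun i =>
    (integrable_const 1).indicator (hA i)
  have hN : ∀ ω, ((Finset.univ.filter fun i => ω ∈ A i).card : ℝ) = N ω := fun ω => by
    simp [N, Set.indicator_apply]
  have hmean : P[N] = ∑ i, P.real (A i) := by
    simp only [N]
    rw [integral_finsetSum _ fun i _ => hI i]
    exact Finset.sum_congr rfl fun i _ => integral_indicator_one (hA i)
  have hL : ∀ i, MemLp ((A i).indicator (1 : α → ℝ)) 2 P := fun i =>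
    (memLp_const (1 : ℝ)).indicator (hA i)
  have hNL : MemLp N 2 P := memLp_finsetSum _ fun i _ => hL i
  have hsq : P[N ^ 2] = ∑ i, ∑ j, P.real (A i ∩ A j) := by
    have : N ^ 2 = fun ω => ∑ i, ∑ j, (A i ∩ A j).indicator (1 : α → ℝ) ω := by
      funext ω
      simp only [N, Pi.pow_apply, sq, Finset.sum_mul_sum, Set.inter_indicator_one, Pi.mul_apply]
    have hI2 : ∀ i j, Integrable ((A i ∩ A j).indicator (1 : α → ℝ)) P := fun i j =>
      (integrable_const 1).indicator ((hA i).inter (hA j))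
    rw [this, integral_finsetSum _ fun i _ => integrable_finsetSum _ fun j _ => hI2 i j]
    refine Finset.sum_congr rfl fun i _ => ?_
    rw [integral_finsetSum _ fun j _ => hI2 i j]
    exact Finset.sum_congr rfl fun j _ => integral_indicator_one ((hA i).inter (hA j))
  have hvar : Var[N; P] ≤ D * ∑ i, P.real (A i) := by
    rw [variance_eq_sub hNL, hsq, hmean, sq, Finset.sum_mul_sum, ← Finset.sum_sub_distrib,
      Finset.mul_sum]
    refine Finset.sum_le_sum fun i _ => ?_
    rw [← Finset.sum_sub_distrib]
    calc ∑ j, (P.real (A i ∩ A j) - P.real (A i) * P.real (A j))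
        ≤ ∑ j, if P.real (A i ∩ A j) ≠ P.real (A i) * P.real (A j) then P.real (A i) else 0 := by
          refine Finset.sum_le_sum fun j _ => ?_
          split_ifs with h
          · have h1 : P.real (A i ∩ A j) ≤ P.real (A i) := measureReal_mono Set.inter_subset_left
            have h2 : 0 ≤ P.real (A i) * P.real (A j) := by positivity
            linarith
          · rw [not_not.1 h, sub_self]
      _ = ((Finset.univ.filter fun j =>
            P.real (A i ∩ A j) ≠ P.real (A i) * P.real (A j)).card : ℝ) * P.real (A i) := by
          rw [← Finset.sum_filter, Finset.sum_const, nsmul_eq_mul]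
      _ ≤ D * P.real (A i) := by
          refine mul_le_mul_of_nonneg_right ?_ measureReal_nonneg
          exact_mod_cast hD i
  have hcheb := ENNReal.toReal_mono ENNReal.ofReal_ne_top (meas_ge_le_variance_div_sq hNL hc)
  rw [ENNReal.toReal_ofReal (by have := variance_nonneg N P; positivity)] at hcheb
  calc _ ≤ P.real {ω | c ≤ |N ω - P[N]|} := by
        refine measureReal_mono fun ω hω => ?_
        have hω' : ((Finset.univ.filter fun i => ω ∈ A i).card : ℝ) ≤ (∑ i, P.real (A i)) - c := hω
        rw [hN ω, ← hmean] at hω'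
        have h : c ≤ -(N ω - P[N]) := by linarith
        exact h.trans (neg_le_abs _)
    _ ≤ Var[N; P] / c ^ 2 := hcheb
    _ ≤ _ := by gcongr

/-! ### The innovated data under the alternative -/

section

variable {ι : Type*} [Fintype ι] {Ω : Matrix ι ι ℝ}

/-- The event that the `i`-th coordinate of the innovated data `Ω β + w`, `w ∼ N(0, Ω)`, is at least
`t` in absolute value. -/
def exceedEvent (Ω : Matrix ι ι ℝ) (t : ℝ) (i : ι) : Set ((ι → ℝ) × EuclideanSpace ℝ ι) :=
  {ω | t ≤ |(Ω *ᵥ ω.1) i + ω.2 i|}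

lemma measurable_mulVec_apply (Ω : Matrix ι ι ℝ) (i : ι) :
    Measurable fun b : ι → ℝ => (Ω *ᵥ b) i := by
  simp only [mulVec, dotProduct]
  fun_prop

lemma measurableSet_exceedEvent (Ω : Matrix ι ι ℝ) (t : ℝ) (i : ι) :
    MeasurableSet (exceedEvent Ω t i) := by
  have := (measurable_mulVec_apply Ω i).comp
    (measurable_fst : Measurable (Prod.fst : (ι → ℝ) × EuclideanSpace ℝ ι → ι → ℝ))
  refine measurableSet_le measurable_const (Measurable.abs (this.add ?_))
  fun_prop

variable {B : ι → Measure ℝ} [∀ i, IsProbabilityMeasure (B i)]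

/-- Means of two innovated coordinates are independent if the rows of `Ω` have disjoint supports. -/
lemma indepFun_mulVec {i j : ι} (h : ∀ k, Ω i k = 0 ∨ Ω j k = 0) :
    IndepFun (fun b : ι → ℝ => (Ω *ᵥ b) i) (fun b => (Ω *ᵥ b) j) (Measure.pi B) := by
  classical
  have hind : iIndepFun (fun k (b : ι → ℝ) => b k) (Measure.pi B) :=
    iIndepFun_pi (X := fun _ => id) fun _ => aemeasurable_id
  set S : ι → Finset ι := fun i => Finset.univ.filter fun k => Ω i k ≠ 0
  have hdisj : Disjoint (S i) (S j) := by
    rw [Finset.disjoint_left]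
    intro k hk hk'
    simp only [S, Finset.mem_filter, Finset.mem_univ, true_and] at hk hk'
    exact (h k).elim hk hk'
  have h2 := hind.indepFun_finset (S i) (S j) hdisj fun k => measurable_pi_apply k
  have hrep : ∀ l, (fun b : ι → ℝ => (Ω *ᵥ b) l) =
      (fun x : S l → ℝ => ∑ k : S l, Ω l k * x k) ∘ fun b k => b k := by
    intro l
    funext b
    simp only [mulVec, dotProduct, Function.comp_apply]
    rw [Finset.sum_coe_sort (S l) fun k => Ω l k * b k, Finset.sum_filter]
    refine Finset.sum_congr rfl fun k _ => ?_
    split_ifs with hk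
    · rfl
    · rw [not_not.1 hk, zero_mul]
  rw [hrep i, hrep j]
  exact h2.comp (by fun_prop) (by fun_prop)

variable [DecidableEq ι]

/-- The innovation `z ↦ Ω z` turns the noise `N(0, Ω⁻¹)` into `N(0, Ω)`. -/
lemma map_mulVec_multivariateGaussian (hΩ : Ω.PosDef) :
    (multivariateGaussian 0 Ω⁻¹).map (fun z => WithLp.toLp 2 (Ω *ᵥ WithLp.ofLp z)) =
      multivariateGaussian 0 Ω := by
  have hm : Measurable fun z : EuclideanSpace ℝ ι => WithLp.toLp 2 (Ω *ᵥ WithLp.ofLp z) :=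
    (toEuclideanCLM (𝕜 := ℝ) Ω).continuous.measurable
  have hsymm : Ωᵀ = Ω := hΩ.isHermitian
  have hprob := Measure.isProbabilityMeasure_map (μ := multivariateGaussian 0 Ω⁻¹) hm.aemeasurable
  refine Measure.ext_of_charFun (funext fun t => ?_)
  have hinner : ∀ z : EuclideanSpace ℝ ι, inner ℝ (WithLp.toLp 2 (Ω *ᵥ WithLp.ofLp z)) t =
      inner ℝ z (WithLp.toLp 2 (Ω *ᵥ WithLp.ofLp t)) := by
    intro z
    simp only [EuclideanSpace.inner_eq_star_dotProduct, star_trivial]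
    rw [dotProduct_mulVec, ← mulVec_transpose, hsymm, dotProduct_comm]
  rw [charFun_apply, integral_map hm.aemeasurable (by fun_prop)]
  simp only [hinner]
  rw [← charFun_apply, charFun_multivariateGaussian hΩ.inv.posSemidef,
    charFun_multivariateGaussian hΩ.posSemidef]
  simp only [inner_zero_right, mulVec_mulVec]
  rw [nonsing_inv_mul _ ((isUnit_iff_isUnit_det _).1 hΩ.isUnit), one_mulVec, dotProduct_comm]

lemma multivariateGaussian_exceedance (hΩ : Ω.PosSemidef) {i : ι} (hi : Ω i i = 1) (t m : ℝ) :
    multivariateGaussian 0 Ω {w | t ≤ |m + w i|} = exceedance t m := by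
  have h := (measurePreserving_eval_multivariateGaussian (μ := 0) hΩ (i := i)).measure_preimage
    (measurableSet_exceedance t m).nullMeasurableSet
  rw [hi] at h
  simpa [exceedance] using h

lemma multivariateGaussian_exceedance_inter (hΩ : Ω.PosSemidef) {i j : ι} (hi : Ω i i = 1)
    (hj : Ω j j = 1) (hij : Ω i j = 0) (t m m' : ℝ) :
    multivariateGaussian 0 Ω ({w | t ≤ |m + w i|} ∩ {w | t ≤ |m' + w j|}) =
      exceedance t m * exceedance t m' := by
  have hlaw : HasGaussianLaw (fun w : EuclideanSpace ℝ ι => (w i, w j))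
      (multivariateGaussian 0 Ω) := by
    have : HasGaussianLaw (id : EuclideanSpace ℝ ι → EuclideanSpace ℝ ι)
      (multivariateGaussian 0 Ω) := IsGaussian.hasGaussianLaw_id
    exact this.map ((EuclideanSpace.proj i).prod (EuclideanSpace.proj j))
  have hind := hlaw.indepFun_of_covariance_eq_zero
    (by rw [covariance_eval_multivariateGaussian hΩ, hij])
  rw [← multivariateGaussian_exceedance hΩ hi, ← multivariateGaussian_exceedance hΩ hj]
  exact hind.measure_inter_preimage_eq_mul _ _ (measurableSet_exceedance t m)
    (measurableSet_exceedance t m')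

lemma prod_exceedEvent {Q : Measure (ι → ℝ)} (hΩ : Ω.PosSemidef) {i : ι} (hi : Ω i i = 1)
    (t : ℝ) : (Q.prod (multivariateGaussian 0 Ω)) (exceedEvent Ω t i) =
      ∫⁻ b, exceedance t ((Ω *ᵥ b) i) ∂Q := by
  rw [Measure.prod_apply (measurableSet_exceedEvent Ω t i)]
  exact lintegral_congr fun b => multivariateGaussian_exceedance hΩ hi t ((Ω *ᵥ b) i)

lemma prod_exceedEvent_inter (hΩ : Ω.PosSemidef) (hdiag : ∀ i, Ω i i = 1) {i j : ι}
    (h : ∀ k, Ω i k = 0 ∨ Ω j k = 0) (t : ℝ) :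
    ((Measure.pi B).prod (multivariateGaussian 0 Ω)) (exceedEvent Ω t i ∩ exceedEvent Ω t j) =
      ((Measure.pi B).prod (multivariateGaussian 0 Ω)) (exceedEvent Ω t i) *
      ((Measure.pi B).prod (multivariateGaussian 0 Ω)) (exceedEvent Ω t j) := by
  have hij : Ω i j = 0 := (h j).resolve_right (by simp [hdiag])
  have hm := measurable_exceedance t
  rw [prod_exceedEvent hΩ (hdiag i), prod_exceedEvent hΩ (hdiag j), Measure.prod_apply
    ((measurableSet_exceedEvent Ω t i).inter (measurableSet_exceedEvent Ω t j))]
  have hmul := lintegral_mul_eq_lintegral_mul_lintegral_of_indepFun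
    (hm.comp (measurable_mulVec_apply Ω i)) (hm.comp (measurable_mulVec_apply Ω j))
    ((indepFun_mulVec (B := B) h).comp hm hm)
  refine Eq.trans (lintegral_congr fun b => ?_) hmul
  exact multivariateGaussian_exceedance_inter hΩ (hdiag i) (hdiag j) hij t
    ((Ω *ᵥ b) i) ((Ω *ᵥ b) j)

/-- An isolated signal of strength `τ` at `i`, which has probability at least `q`, raises the
exceedance probability; whatever the other signals are, it does not drop below its null value. -/
lemma le_prod_exceedEvent (hΩ : Ω.PosSemidef) {i : ι} (hi : Ω i i = 1) {t τ q : ℝ} (ht : 0 ≤ t)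
    (hq : q ≤ (Measure.pi B).real
      {b | b i = τ ∧ ∀ k, k ≠ i → Ω i k ≠ 0 → b k = 0}) :
    twoSidedPValue t + q * ((exceedance t τ).toReal - twoSidedPValue t) ≤
      ((Measure.pi B).prod (multivariateGaussian 0 Ω)).real (exceedEvent Ω t i) := by
  set E : Set (ι → ℝ) := {b | b i = τ ∧ ∀ k, k ≠ i → Ω i k ≠ 0 → b k = 0}
  have hE : MeasurableSet E := by
    refine MeasurableSet.inter (measurableSet_eq_fun (by fun_prop) measurable_const) ?_
    change MeasurableSet {b : ι → ℝ | ∀ k, k ≠ i → Ω i k ≠ 0 → b k = 0}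
    simp only [Set.ofPred_forall]
    exact MeasurableSet.iInter fun k => MeasurableSet.iInter fun _ => MeasurableSet.iInter fun _ =>
      measurableSet_eq_fun (by fun_prop) measurable_const
  have hm : Measurable fun b : ι → ℝ => exceedance t ((Ω *ᵥ b) i) :=
    (measurable_exceedance t).comp (measurable_mulVec_apply Ω i)
  rw [measureReal_def, prod_exceedEvent hΩ hi, ← integral_toReal hm.aemeasurable
    (Eventually.of_forall fun b => (exceedance_ne_top _ _).lt_top)]
  have h0 : ∀ m, twoSidedPValue t ≤ (exceedance t m).toReal := fun m => by
    rw [← exceedance_zero t ht]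
    exact ENNReal.toReal_mono (exceedance_ne_top _ _) (exceedance_zero_le ht m)
  set g := (exceedance t τ).toReal - twoSidedPValue t
  have hg : 0 ≤ g := sub_nonneg.2 (h0 τ)
  have hle : ∀ b, twoSidedPValue t + E.indicator (fun _ => g) b ≤
      (exceedance t ((Ω *ᵥ b) i)).toReal := by
    intro b
    by_cases hb : b ∈ E
    · have hmean : (Ω *ᵥ b) i = τ := by
        rw [mulVec, dotProduct, Finset.sum_eq_single i, hi, one_mul, hb.1]
        · intro k _ hk
          by_cases hΩk : Ω i k = 0
          · rw [hΩk, zero_mul]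
          · rw [hb.2 k hk hΩk, mul_zero]
        · simp
      rw [Set.indicator_of_mem hb, hmean]
      simp only [g]
      linarith
    · rw [Set.indicator_of_notMem hb, add_zero]
      exact h0 _
  have hint : Integrable (fun b => (exceedance t ((Ω *ᵥ b) i)).toReal) (Measure.pi B) :=
    Integrable.of_bound hm.ennreal_toReal.aestronglyMeasurable 1 (Eventually.of_forall fun b => by
      rw [Real.norm_of_nonneg ENNReal.toReal_nonneg]
      exact ENNReal.toReal_le_of_le_ofReal zero_le_one (by simpa using exceedance_le_one t _))
  have hind : Integrable (E.indicator fun _ => g) (Measure.pi B) :=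
    (integrable_const g).indicator hE
  have hsum : ∫ b, (twoSidedPValue t + E.indicator (fun _ => g) b) ∂(Measure.pi B) =
      twoSidedPValue t + (Measure.pi B).real E * g := by
    rw [integral_add (integrable_const _) hind, integral_indicator_const _ hE]
    simp
  have := integral_mono ((integrable_const (twoSidedPValue t)).add hind) hint hle
  change ∫ b, (twoSidedPValue t + E.indicator (fun _ => g) b) ∂(Measure.pi B) ≤ _ at this
  rw [hsum] at this
  linarith [mul_le_mul_of_nonneg_right hq hg]

end

lemma le_twoPoint_singleton_zero (ε τ : ℝ) : ENNReal.ofReal (1 - ε) ≤ twoPoint ε τ {0} := by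
  simp [twoPoint]

lemma le_twoPoint_singleton (ε τ : ℝ) : ENNReal.ofReal ε ≤ twoPoint ε τ {τ} := by
  simp [twoPoint]

/-- The probability of an isolated signal: `ε` for the signal itself, times at least `1 - ε` for
each of the other coordinates in the support of the row. -/
lemma le_pi_twoPoint_isolated {p : ℕ} (Ω : Matrix (Fin p) (Fin p) ℝ) {ε τ : ℝ}
    (hε : ε ∈ Set.Icc (0 : ℝ) 1) (i : Fin p) :
    ε * (1 - maxRowNonzeros Ω * ε) ≤ (Measure.pi fun _ : Fin p => twoPoint ε τ).real
      {b | b i = τ ∧ ∀ k, k ≠ i → Ω i k ≠ 0 → b k = 0} := by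
  classical
  have : Fact (ε ∈ Set.Icc (0 : ℝ) 1) := ⟨hε⟩
  have hε1 : 0 ≤ 1 - ε := sub_nonneg.2 hε.2
  set s : Fin p → Set ℝ := fun k =>
    if k = i then {τ} else if Ω i k ≠ 0 then {0} else Set.univ
  set c : Fin p → ℝ := fun k => if k = i then ε else if Ω i k ≠ 0 then 1 - ε else 1
  have hc0 : ∀ k, 0 ≤ c k := fun k => by
    simp only [c]; split_ifs <;> [exact hε.1; exact hε1; exact zero_le_one]
  have hcs : ∀ k, ENNReal.ofReal (c k) ≤ twoPoint ε τ (s k) := fun k => by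
    simp only [c, s]
    split_ifs
    · exact le_twoPoint_singleton ε τ
    · exact le_twoPoint_singleton_zero ε τ
    · simp
  have hset : {b : Fin p → ℝ | b i = τ ∧ ∀ k, k ≠ i → Ω i k ≠ 0 → b k = 0} = Set.univ.pi s := by
    ext b
    simp only [Set.mem_ofPred_eq, Set.mem_pi, Set.mem_univ, true_imp_iff, s]
    constructor
    · rintro ⟨h1, h2⟩ k
      split_ifs with hk hk'
      · subst hk; exact h1
      · exact h2 k hk hk'
      · trivial
    · intro h
      refine ⟨by simpa using h i, fun k hk hk' => ?_⟩
      have := h k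
      rw [if_neg hk, if_pos hk'] at this
      exact this
  have hprod : ε * (1 - maxRowNonzeros Ω * ε) ≤ ∏ k, c k := by
    rw [← Finset.mul_prod_erase Finset.univ c (Finset.mem_univ i)]
    have h1 : c i = ε := if_pos rfl
    have h2 : ∏ k ∈ Finset.univ.erase i, c k =
        (1 - ε) ^ ((Finset.univ.erase i).filter fun k => Ω i k ≠ 0).card := by
      rw [← Finset.prod_const, Finset.prod_filter]
      refine Finset.prod_congr rfl fun k hk => ?_
      simp only [c]
      rw [if_neg (Finset.ne_of_mem_erase hk)]
    rw [h1, h2]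
    refine mul_le_mul_of_nonneg_left ?_ hε.1
    set n := ((Finset.univ.erase i).filter fun k => Ω i k ≠ 0).card
    have hn : n ≤ maxRowNonzeros Ω :=
      (Finset.card_le_card (Finset.filter_subset_filter _ (Finset.erase_subset _ _))).trans
        (card_row_le Ω i)
    have hb := one_add_mul_le_pow (a := -ε) (by linarith [hε.2]) n
    have hn' : (n : ℝ) ≤ maxRowNonzeros Ω := by exact_mod_cast hn
    calc 1 - maxRowNonzeros Ω * ε ≤ 1 + n * -ε := by
          linarith [mul_le_mul_of_nonneg_right hn' hε.1]
      _ ≤ _ := hb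
      _ = _ := by rw [← sub_eq_add_neg]
  refine hprod.trans ?_
  rw [hset, measureReal_def, Measure.pi_pi,
    ← ENNReal.ofReal_le_iff_le_toReal (ENNReal.prod_ne_top fun k _ => measure_ne_top _ _),
    ENNReal.ofReal_prod_of_nonneg fun k _ => hc0 k]
  exact Finset.prod_le_prod' fun k _ => hcs k

open Classical in
/-- At most `d_p^*(Ω)²` rows have a support that meets the support of a given row. -/
lemma card_overlap_le {p : ℕ} {Ω : Matrix (Fin p) (Fin p) ℝ} (hsymm : ∀ i j, Ω i j = Ω j i)
    (i : Fin p) :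
    (Finset.univ.filter fun j => ∃ k, Ω i k ≠ 0 ∧ Ω j k ≠ 0).card ≤ maxRowNonzeros Ω ^ 2 := by
  have hsub : (Finset.univ.filter fun j => ∃ k, Ω i k ≠ 0 ∧ Ω j k ≠ 0) ⊆
      (Finset.univ.filter fun k => Ω i k ≠ 0).biUnion
        fun k => Finset.univ.filter fun j => Ω k j ≠ 0 := by
    intro j hj
    simp only [Finset.mem_filter, Finset.mem_univ, true_and, Finset.mem_biUnion] at hj ⊢
    obtain ⟨k, hk, hk'⟩ := hj
    exact ⟨k, hk, by rwa [hsymm]⟩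
  refine (Finset.card_le_card hsub).trans ((Finset.card_biUnion_le_card_mul _ _ _
    fun k _ => card_row_le Ω k).trans ?_)
  rw [sq]
  exact Nat.mul_le_mul_right _ (card_row_le Ω i)

/-! ### The detectable region -/

/-- Under the alternative the innovated data `Ω Y` are `Ω β + w` with `w ∼ N(0, Ω)`. -/
lemma map_mulVec_altLaw {ϑ r : ℝ} {p : ℕ} {Ω : Matrix (Fin p) (Fin p) ℝ} (hΩ : Ω.PosDef)
    (hε : signalFraction ϑ p ∈ Set.Icc (0 : ℝ) 1) :
    (altLaw ϑ r Ω).map (fun y => WithLp.toLp 2 (Ω *ᵥ WithLp.ofLp y)) =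
      ((Measure.pi fun _ : Fin p => twoPoint (signalFraction ϑ p) (signalStrength r p)).prod
        (multivariateGaussian 0 Ω)).map
        (fun ω => WithLp.toLp 2 (Ω *ᵥ ω.1) + ω.2) := by
  have : Fact (signalFraction ϑ p ∈ Set.Icc (0 : ℝ) 1) := ⟨hε⟩
  have hm : Measurable fun z : EuclideanSpace ℝ (Fin p) =>
      (WithLp.toLp 2 (Ω *ᵥ WithLp.ofLp z) : EuclideanSpace ℝ (Fin p)) :=
    (toEuclideanCLM (𝕜 := ℝ) Ω).continuous.measurable
  have hm1 : Measurable fun b : Fin p → ℝ =>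
      (WithLp.toLp 2 (Ω *ᵥ b) : EuclideanSpace ℝ (Fin p)) :=
    hm.comp (g := fun z : EuclideanSpace ℝ (Fin p) =>
      (WithLp.toLp 2 (Ω *ᵥ WithLp.ofLp z) : EuclideanSpace ℝ (Fin p)))
      (f := fun b : Fin p → ℝ => (WithLp.toLp 2 b : EuclideanSpace ℝ (Fin p))) (by fun_prop)
  have hm2 : Measurable fun ω : (Fin p → ℝ) × EuclideanSpace ℝ (Fin p) =>
      (WithLp.toLp 2 (Ω *ᵥ ω.1) + ω.2 : EuclideanSpace ℝ (Fin p)) :=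
    (hm1.comp measurable_fst).add measurable_snd
  have h := Measure.map_prod_map
    (Measure.pi fun _ : Fin p => twoPoint (signalFraction ϑ p) (signalStrength r p))
    (multivariateGaussian (0 : EuclideanSpace ℝ (Fin p)) Ω⁻¹) measurable_id hm
  rw [Measure.map_id, map_mulVec_multivariateGaussian hΩ] at h
  rw [h, altLaw, Measure.map_map hm (by fun_prop), Measure.map_map hm2 (measurable_id.prodMap hm)]
  congr 1
  funext ω
  simp [mulVec_add]

lemma measurable_card_exceed {p : ℕ} (t : ℝ) : Measurable fun w : EuclideanSpace ℝ (Fin p) =>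
    ((Finset.univ.filter fun i => t ≤ |w i|).card : ℝ) := by
  have : (fun w : EuclideanSpace ℝ (Fin p) =>
      ((Finset.univ.filter fun i => t ≤ |w i|).card : ℝ)) =
      fun w => ∑ i, if t ≤ |w i| then (1 : ℝ) else 0 := by
    funext w
    simp
  rw [this]
  refine Finset.measurable_sum _ fun i _ => Measurable.ite ?_ measurable_const measurable_const
  exact measurableSet_le measurable_const (by fun_prop)

/-- If the number of coordinates of size at least `t` exceeds its null mean `p u` by half of `Δ`,
then Higher Criticism is large. -/
lemma le_higherCriticism_of_card {p : ℕ} (hp : 4 ≤ p) (x : Fin p → ℝ) {t Δ v : ℝ} (ht : 0 ≤ t)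
    (hΔ : 0 < Δ) (hu : twoSidedPValue t ≤ 1 / 8)
    (hcard : p * twoSidedPValue t + Δ / 2 < (Finset.univ.filter fun i => t ≤ |x i|).card)
    (hv1 : v ≤ Δ / (2 * √(p * twoSidedPValue t))) (hv2 : v ≤ √p / 4) :
    v ≤ higherCriticism fun i => twoSidedPValue (x i) := by
  set u := twoSidedPValue t
  have hu0 : 0 < u := twoSidedPValue_pos t
  have hp0 : (0 : ℝ) < p := by positivity
  have hpu : 0 < p * u := mul_pos hp0 hu0
  set N := (Finset.univ.filter fun i => t ≤ |x i|).card
  have hN0 : 0 < N := by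
    have : (0 : ℝ) < N := by linarith
    exact_mod_cast this
  have hNu : N ≤ (Finset.univ.filter fun i => twoSidedPValue (x i) ≤ u).card := by
    refine Finset.card_le_card fun i hi => ?_
    simp only [Finset.mem_filter, Finset.mem_univ, true_and] at hi ⊢
    exact twoSidedPValue_anti (by rwa [abs_of_nonneg ht])
  have hsu : 0 < √u := Real.sqrt_pos.2 hu0
  have hsp : 0 < √(p : ℝ) := Real.sqrt_pos.2 hp0
  have hspp : √(p : ℝ) * √(p : ℝ) = p := Real.mul_self_sqrt hp0.le
  have hpos : ∀ i, 0 < twoSidedPValue (x i) := fun i => twoSidedPValue_pos _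
  rcases le_total N (p / 2) with h | h
  · have h1 : Δ / 2 / p ≤ (N : ℝ) / p - u := by
      rw [div_le_iff₀ hp0, sub_mul, div_mul_cancel₀ _ hp0.ne']
      linarith
    have h0 : 0 ≤ Δ / 2 / p := by positivity
    refine hv1.trans (le_trans ?_ (le_higherCriticism hpos (by linarith) hN0 (by omega) hNu
      (by linarith)))
    rw [Real.sqrt_mul hp0.le]
    calc Δ / (2 * (√p * √u)) = √p * (Δ / 2 / p) / √u := by
          rw [show Δ / 2 / (p : ℝ) = Δ / 2 / (√p * √p) by rw [hspp]]
          field_simp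
      _ ≤ _ := by gcongr
  -- with more than `p / 2` exceedances, Higher Criticism is restricted to the index `p / 2`
  · have hk : (p : ℝ) ≤ 2 * ((p / 2 : ℕ) : ℝ) + 1 := by
      have : p ≤ 2 * (p / 2) + 1 := by omega
      exact_mod_cast this
    have hp4 : (4 : ℝ) ≤ p := by exact_mod_cast hp
    have h1 : 1 / 4 ≤ ((p / 2 : ℕ) : ℝ) / p - u := by
      have : 3 / 8 ≤ ((p / 2 : ℕ) : ℝ) / p := by rw [le_div_iff₀ hp0]; linarith
      linarith
    refine hv2.trans (le_trans ?_ (le_higherCriticism hpos (by linarith) (k := p / 2) (by omega)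
      (by omega) (h.trans hNu) (by linarith)))
    have hsu1 : √u ≤ 1 := Real.sqrt_le_one.2 (by linarith)
    rw [le_div_iff₀ hsu]
    calc √(p : ℝ) / 4 * √u ≤ √p / 4 * 1 := by gcongr
      _ = √p * (1 / 4) := by ring
      _ ≤ _ := by gcongr

/-- A lower bound for the probability that Innovated Higher Criticism is at least `v`, from
Chebyshev's inequality for the number of exceedances of `t`. -/
lemma le_altLaw_innovatedHC {ϑ r : ℝ} {p : ℕ} (hp : 4 ≤ p) {Ω : Matrix (Fin p) (Fin p) ℝ}
    (hΩ : Ω.PosDef) (hdiag : ∀ i, Ω i i = 1) (hε : signalFraction ϑ p ∈ Set.Icc (0 : ℝ) 1)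
    {t Δ v : ℝ} (ht : 0 ≤ t) (hu : twoSidedPValue t ≤ 1 / 8) (hΔ0 : 0 < Δ)
    (hΔ : Δ ≤ p * (signalFraction ϑ p * (1 - maxRowNonzeros Ω * signalFraction ϑ p) *
      ((exceedance t (signalStrength r p)).toReal - twoSidedPValue t)))
    (hv1 : v ≤ Δ / (2 * √(p * twoSidedPValue t))) (hv2 : v ≤ √p / 4) :
    1 - 4 * (maxRowNonzeros Ω : ℝ) ^ 2 * (p * twoSidedPValue t / Δ ^ 2 + 1 / Δ) ≤
      (altLaw ϑ r Ω).real {y | v ≤ innovatedHC Ω y} := by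
  classical
  have : Fact (signalFraction ϑ p ∈ Set.Icc (0 : ℝ) 1) := ⟨hε⟩
  have hprob := isProbabilityMeasure_altLaw r Ω hε
  have hsymm : ∀ i j, Ω i j = Ω j i := fun i j => by
    have := congrFun (congrFun hΩ.isHermitian j) i
    simpa using this
  set M := (Measure.pi fun _ : Fin p => twoPoint (signalFraction ϑ p) (signalStrength r p)).prod
    (multivariateGaussian (0 : EuclideanSpace ℝ (Fin p)) Ω)
  set u := twoSidedPValue t
  have hu0 : 0 < u := twoSidedPValue_pos t
  have hp0 : (0 : ℝ) < p := by positivity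
  set m := ∑ i, M.real (exceedEvent Ω t i)
  have hm : p * u + Δ ≤ m := by
    have : ∑ _i : Fin p, (u + signalFraction ϑ p * (1 - maxRowNonzeros Ω * signalFraction ϑ p) *
        ((exceedance t (signalStrength r p)).toReal - u)) ≤ m :=
      Finset.sum_le_sum fun i _ => le_prod_exceedEvent hΩ.posSemidef (hdiag i) ht
        (le_pi_twoPoint_isolated Ω hε i)
    rw [Finset.sum_const, Finset.card_univ, Fintype.card_fin, nsmul_eq_mul, mul_add] at this
    linarith
  set c := (m - p * u) / 2
  have hc0 : 0 < c := by simp only [c]; linarith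
  have hcheb := measureReal_card_le M (A := exceedEvent Ω t) (measurableSet_exceedEvent Ω t)
    (D := maxRowNonzeros Ω ^ 2) (fun i => by
      refine le_trans (Finset.card_le_card fun j hj => ?_) (card_overlap_le hsymm i)
      simp only [Finset.mem_filter, Finset.mem_univ, true_and] at hj ⊢
      by_contra hne
      push Not at hne
      refine hj ?_
      rw [measureReal_def, prod_exceedEvent_inter hΩ.posSemidef hdiag
        (fun k => or_iff_not_imp_left.2 (hne k)) t, ENNReal.toReal_mul,
        measureReal_def, measureReal_def]) hc0
  set f : EuclideanSpace ℝ (Fin p) → EuclideanSpace ℝ (Fin p) :=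
    fun y => WithLp.toLp 2 (Ω *ᵥ WithLp.ofLp y)
  have hf : Measurable f := (toEuclideanCLM (𝕜 := ℝ) Ω).continuous.measurable
  set g : (Fin p → ℝ) × EuclideanSpace ℝ (Fin p) → EuclideanSpace ℝ (Fin p) :=
    fun ω => WithLp.toLp 2 (Ω *ᵥ ω.1) + ω.2
  have hg : Measurable g := by
    have h1 : Measurable fun b : Fin p → ℝ => f (WithLp.toLp 2 b) := hf.comp (by fun_prop)
    exact (h1.comp measurable_fst).add measurable_snd
  set S : Set (EuclideanSpace ℝ (Fin p)) :=
    {w | ((Finset.univ.filter fun i => t ≤ |w i|).card : ℝ) ≤ m - c}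
  have hS : MeasurableSet S := measurableSet_le (measurable_card_exceed t) measurable_const
  have htransfer : (altLaw ϑ r Ω).real (f ⁻¹' S) = M.real (g ⁻¹' S) := by
    rw [← map_measureReal_apply hf hS, ← map_measureReal_apply hg hS, map_mulVec_altLaw hΩ hε]
  have hMS : M.real (g ⁻¹' S) ≤ (maxRowNonzeros Ω ^ 2 : ℕ) * m / c ^ 2 := hcheb
  have hsub : (f ⁻¹' S)ᶜ ⊆ {y | v ≤ innovatedHC Ω y} := by
    intro y hy
    have hy' : m - c < ((Finset.univ.filter fun i => t ≤ |(Ω *ᵥ WithLp.ofLp y) i|).card : ℝ) :=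
      not_le.1 hy
    refine le_higherCriticism_of_card hp _ ht hΔ0 hu (lt_of_le_of_lt ?_ hy') hv1 hv2
    simp only [c]
    linarith
  have hle := measureReal_mono (μ := altLaw ϑ r Ω) hsub
  rw [probReal_compl_eq_one_sub (hf hS), htransfer] at hle
  -- the bound of Chebyshev's inequality is decreasing in the excess of the mean
  have hfinal : ((maxRowNonzeros Ω ^ 2 : ℕ) : ℝ) * m / c ^ 2 ≤
      4 * (maxRowNonzeros Ω : ℝ) ^ 2 * (p * u / Δ ^ 2 + 1 / Δ) := by
    have e : ((maxRowNonzeros Ω ^ 2 : ℕ) : ℝ) * m / c ^ 2 =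
        4 * (maxRowNonzeros Ω : ℝ) ^ 2 * (p * u / (m - p * u) ^ 2 + 1 / (m - p * u)) := by
      have hne : m - p * u ≠ 0 := by linarith
      simp only [c]
      push_cast
      field_simp
      ring
    have hpu : 0 ≤ p * u := by positivity
    have hd : Δ ≤ m - p * u := by linarith
    rw [e]
    gcongr
  linarith

lemma exists_threshold {ϑ r : ℝ} (hϑ1 : ϑ < 1) (hr : 0 < r) (h : phaseFunction ϑ < r) :
    ∃ q : ℝ, 0 < q ∧ q ≤ 1 ∧ 0 < 1 / 2 - ϑ - (max (√q - √r) 0) ^ 2 + q / 2 := by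
  set s := √(1 - ϑ)
  have hs0 : 0 ≤ s := Real.sqrt_nonneg _
  have hs : s ^ 2 = 1 - ϑ := Real.sq_sqrt (by linarith)
  have hr2 : √r ^ 2 = r := Real.sq_sqrt hr.le
  have hr0 : 0 ≤ √r := Real.sqrt_nonneg r
  by_cases hr4 : r ≤ 1 / 4
  -- for weak signals the threshold `2τ` is optimal
  · refine ⟨4 * r, by linarith, by linarith, ?_⟩
    have h4 : √(4 * r) = 2 * √r := by
      rw [Real.sqrt_mul (by norm_num), show (4 : ℝ) = 2 ^ 2 by norm_num,
        Real.sqrt_sq (by norm_num)]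
    rw [h4, max_eq_left (by linarith), show 2 * √r - √r = √r by ring, hr2]
    rw [phaseFunction] at h
    split_ifs at h with h1 h2
    · linarith
    · linarith
    · have hs2 : s < 1 / 2 := by nlinarith
      nlinarith
  · refine ⟨1, one_pos, le_rfl, ?_⟩
    rw [Real.sqrt_one]
    have hr12 : 1 / 2 < √r := Real.lt_sqrt_of_sq_lt (by linarith [not_le.1 hr4])
    rcases le_total 1 (√r) with h1 | h1
    · rw [max_eq_right (by linarith)]
      linarith
    · rw [max_eq_left (by linarith)]
      have hkey : 1 - s < √r := by
        rcases le_or_gt ϑ (3 / 4) with h34 | h34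
        · have : 1 / 2 ≤ s := Real.le_sqrt_of_sq_le (by linarith)
          linarith
        · rw [phaseFunction, if_neg (by linarith), if_neg (by linarith)] at h
          exact Real.lt_sqrt_of_sq_lt h
      nlinarith

/-! ### Asymptotics of the Innovated Higher Criticism test -/

/-- Polynomial lower bound for the exceedance probability at the threshold `√(2 q log p)` of a
signal of strength `√(2 r log p)`. -/
lemma exists_le_exceedance {r q δ : ℝ} (hr : 0 < r) (hq : 0 < q) (hδ : 0 < δ) :
    ∃ C : ℝ, 0 < C ∧ ∀ p : ℕ, 2 ≤ p → C * (p : ℝ) ^ (-((max (√q - √r) 0) ^ 2 + δ)) ≤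
      (exceedance √(2 * q * Real.log p) (signalStrength r p)).toReal := by
  set a := max (√q - √r) 0
  have ha0 : 0 ≤ a := le_max_right _ _
  refine ⟨(√(2 * Real.pi))⁻¹ * Real.exp (-(a ^ 2 / (2 * δ) + 1 / 2)), by positivity,
    fun p hp => ?_⟩
  have hp0 : (0 : ℝ) < p := by positivity
  set L := Real.log p
  have hL : 0 ≤ L := Real.log_natCast_nonneg p
  set w := √(2 * L)
  have hw0 : 0 ≤ w := Real.sqrt_nonneg _
  have hw2 : w ^ 2 = 2 * L := Real.sq_sqrt (by positivity)
  have ht : √(2 * q * L) = √q * w := by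
    rw [mul_comm 2 q, mul_assoc, Real.sqrt_mul hq.le]
  have hτ : signalStrength r p = √r * w := signalStrength_eq hr.le p
  refine le_trans ?_ (exp_le_exceedance (s := a * w) (by positivity) ?_)
  · rw [Real.rpow_def_of_pos hp0, mul_assoc, ← Real.exp_add]
    refine mul_le_mul_of_nonneg_left (Real.exp_le_exp.2 ?_) (by positivity)
    -- the cross term `a w` is at most `δ L + a² / (2 δ)`
    have hcross : a * w ≤ δ * L + a ^ 2 / (2 * δ) := by
      have h1 : 0 ≤ (δ * w - a) ^ 2 / (2 * δ) := by positivity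
      have h2 : (δ * w - a) ^ 2 / (2 * δ) = δ * (w ^ 2) / 2 - a * w + a ^ 2 / (2 * δ) := by
        field_simp
        ring
      rw [h2, hw2] at h1
      linarith
    have h3 : (a * w + 1) ^ 2 = a ^ 2 * (2 * L) + 2 * (a * w) + 1 := by rw [← hw2]; ring
    rw [h3]
    linarith
  · rw [ht, hτ, ← sub_mul]
    exact mul_le_mul_of_nonneg_right (le_max_left _ _) hw0

lemma tendsto_natCast_rpow_neg {b : ℝ} (hb : 0 < b) :
    Tendsto (fun p : ℕ => (p : ℝ) ^ (-b)) atTop (𝓝 0) :=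
  (tendsto_rpow_neg_atTop hb).comp tendsto_natCast_atTop_atTop

lemma twoSidedPValue_threshold_le {q : ℝ} (hq : 0 < q) {p : ℕ} (hp : 2 ≤ p) :
    twoSidedPValue √(2 * q * Real.log p) ≤ 2 * (p : ℝ) ^ (-q) := by
  have hp0 : (0 : ℝ) < p := by positivity
  have hL : 0 ≤ Real.log p := Real.log_natCast_nonneg p
  refine (twoSidedPValue_le (Real.sqrt_nonneg _)).trans (le_of_eq ?_)
  rw [Real.sq_sqrt (by positivity), Real.rpow_def_of_pos hp0]
  congr 2
  ring

/-- The critical value of the IHC test grows more slowly than every power of `p`. -/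
lemma tendsto_maxRowNonzeros_mul_criticalValue {Ω : ∀ p : ℕ, Matrix (Fin p) (Fin p) ℝ}
    (hΩ : IsSparsePrecision Ω) {α : ℕ → ℝ} (hα : TendsToZeroSlowly α) {b : ℝ} (hb : 0 < b) :
    Tendsto (fun p : ℕ => (maxRowNonzeros (Ω p) : ℝ) * criticalValue p (α p) * (p : ℝ) ^ (-b))
      atTop (𝓝 0) := by
  have h1 : (fun p : ℕ => criticalValue p (α p)) =O[atTop] fun p : ℕ => (p : ℝ) ^ (b / 2) := by
    refine hα.2.2.isBigO.trans ?_
    have hlog : (fun p : ℕ => Real.log p) =O[atTop] fun p : ℕ => (p : ℝ) ^ (b / 2) :=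
      ((isLittleO_log_rpow_atTop (half_pos hb)).comp_tendsto tendsto_natCast_atTop_atTop).isBigO
    refine Asymptotics.IsBigO.trans (Asymptotics.IsBigO.of_bound 2 ?_) hlog
    filter_upwards [(Real.tendsto_log_atTop.comp tendsto_natCast_atTop_atTop).eventually_ge_atTop 1]
      with p hp
    have hp' : 1 ≤ Real.log p := hp
    rw [Real.norm_of_nonneg (Real.sqrt_nonneg _), Real.norm_of_nonneg (by linarith)]
    refine Real.sqrt_le_iff.2 ⟨by linarith, ?_⟩
    have := Real.log_le_sub_one_of_pos (show 0 < Real.log p by linarith)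
    nlinarith
  have h2 := hΩ.sparse (b / 2) (half_pos hb)
  obtain ⟨K, hK⟩ := h1.bound
  have h3 := h2.const_mul K
  rw [mul_zero] at h3
  refine squeeze_zero_norm' ?_ h3
  filter_upwards [hK, eventually_ge_atTop 2] with p hKp hp
  have hp0 : (0 : ℝ) < p := by positivity
  rw [Real.norm_of_nonneg (by positivity : (0 : ℝ) ≤ (p : ℝ) ^ (b / 2))] at hKp
  rw [norm_mul, norm_mul, Real.norm_of_nonneg (by positivity : (0 : ℝ) ≤ (p : ℝ) ^ (-b)),
    Real.norm_of_nonneg (Nat.cast_nonneg _)]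
  have e : (p : ℝ) ^ (b / 2) * (p : ℝ) ^ (-b) = (p : ℝ) ^ (-(b / 2)) := by
    rw [← Real.rpow_add hp0]; congr 1; ring
  calc _ ≤ (maxRowNonzeros (Ω p) : ℝ) * (K * (p : ℝ) ^ (b / 2)) * (p : ℝ) ^ (-b) := by gcongr
    _ = K * ((maxRowNonzeros (Ω p) : ℝ) * ((p : ℝ) ^ (b / 2) * (p : ℝ) ^ (-b))) := by ring
    _ = _ := by rw [e]

theorem tendsto_ihcPower {ϑ r : ℝ} (hϑ0 : 0 < ϑ) (hϑ1 : ϑ < 1) (hr : 0 < r)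
    {Ω : ∀ p : ℕ, Matrix (Fin p) (Fin p) ℝ} (hΩ : IsSparsePrecision Ω)
    (h : phaseFunction ϑ < r) {α : ℕ → ℝ} (hα : TendsToZeroSlowly α) :
    Tendsto (fun p : ℕ => ihcPower ϑ r (Ω p) (α p)) atTop (𝓝 1) := by
  obtain ⟨q, hq0, hq1, hγ⟩ := exists_threshold hϑ1 hr h
  set κ := (max (√q - √r) 0) ^ 2
  set γ := 1 / 2 - ϑ - κ + q / 2
  have hκq : κ < q := by
    have h1 : 0 < √q := Real.sqrt_pos.2 hq0
    have h2 : 0 < √r := Real.sqrt_pos.2 hr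
    calc κ < √q ^ 2 := pow_lt_pow_left₀ (max_lt (by linarith) h1) (le_max_right _ _) two_ne_zero
      _ = q := Real.sq_sqrt hq0.le
  obtain ⟨δ, hδ0, hδγ, hδq⟩ : ∃ δ : ℝ, 0 < δ ∧ δ < γ ∧ κ + δ < q :=
    ⟨min γ (q - κ) / 2, half_pos (lt_min hγ (by linarith)),
      by linarith [min_le_left γ (q - κ)], by linarith [min_le_right γ (q - κ)]⟩
  obtain ⟨C, hC0, hC⟩ := exists_le_exceedance hr hq0 hδ0
  set C' := C / 4
  have hC'0 : 0 < C' := by positivity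
  -- the mean number of exceedances is at least `C' p ^ a` above its null value
  set a := 1 - ϑ - κ - δ
  have ha : 0 < a := by simp only [a, γ] at hδγ ⊢; linarith
  set b := γ - δ
  have hb : 0 < b := by linarith
  have hbound : ∀ᶠ p : ℕ in atTop, 1 - (8 / C' ^ 2 *
      ((maxRowNonzeros (Ω p) : ℝ) * (p : ℝ) ^ (-b)) ^ 2 +
      4 / C' * ((maxRowNonzeros (Ω p) : ℝ) * (p : ℝ) ^ (-(a / 2))) ^ 2) ≤
      ihcPower ϑ r (Ω p) (α p) := by
    have ev1 : ∀ᶠ p : ℕ in atTop, (p : ℝ) ^ (-q) < 1 / 16 :=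
      (tendsto_natCast_rpow_neg hq0).eventually_lt_const (by norm_num)
    have ev2 : ∀ᶠ p : ℕ in atTop, (p : ℝ) ^ (-(q - (κ + δ))) < C / 4 :=
      (tendsto_natCast_rpow_neg (by linarith)).eventually_lt_const (by positivity)
    have ev3 := (hΩ.sparse ϑ hϑ0).eventually_lt_const (show (0 : ℝ) < 1 / 2 by norm_num)
    have ev4 := (tendsto_maxRowNonzeros_mul_criticalValue hΩ hα hb).eventually_lt_const
      (show (0 : ℝ) < C' / 4 by positivity)
    have ev5 := (tendsto_maxRowNonzeros_mul_criticalValue hΩ hα one_half_pos).eventually_lt_const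
      (show (0 : ℝ) < 1 / 4 by norm_num)
    filter_upwards [ev1, ev2, ev3, ev4, ev5, eventually_ge_atTop 4] with p h1 h2 h3 h4 h5 hp
    have hp2 : 2 ≤ p := by omega
    have hp0 : (0 : ℝ) < p := by positivity
    have hε := signalFraction_mem_Icc hϑ0 hp2
    set t := √(2 * q * Real.log p)
    have hut : twoSidedPValue t ≤ 2 * (p : ℝ) ^ (-q) := twoSidedPValue_threshold_le hq0 hp2
    have hu0 := twoSidedPValue_pos t
    have hexc := hC p hp2
    set Δ := C' * (p : ℝ) ^ a
    have hΔ0 : 0 < Δ := by positivity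
    set x := (p : ℝ) ^ (-(κ + δ))
    have hx0 : 0 < x := by positivity
    have hux : 2 * (p : ℝ) ^ (-q) ≤ C / 2 * x := by
      have e : (p : ℝ) ^ (-q) = (p : ℝ) ^ (-(q - (κ + δ))) * x := by
        rw [← Real.rpow_add hp0]; congr 1; ring
      rw [e]
      nlinarith
    have hgap : C / 2 * x ≤ (exceedance t (signalStrength r p)).toReal - twoSidedPValue t := by
      linarith
    have hΔ : Δ ≤ p * (signalFraction ϑ p * (1 - maxRowNonzeros (Ω p) * signalFraction ϑ p) *
        ((exceedance t (signalStrength r p)).toReal - twoSidedPValue t)) := by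
      have e : (p : ℝ) ^ a = p * (signalFraction ϑ p * x) := by
        rw [signalFraction, ← Real.rpow_add hp0, ← Real.rpow_one_add' hp0.le]
        · congr 1; simp only [a]; ring
        · exact ne_of_gt (by linarith)
      calc Δ = p * (signalFraction ϑ p * (1 / 2) * (C / 2 * x)) := by
            simp only [Δ, C', e]; ring
        _ ≤ _ := by
            have h6 : 1 / 2 ≤ 1 - maxRowNonzeros (Ω p) * signalFraction ϑ p := by
              have : (maxRowNonzeros (Ω p) : ℝ) * signalFraction ϑ p < 1 / 2 := h3
              linarith
            have h7 := hε.1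
            have h8 : 0 ≤ C / 2 * x := by positivity
            have h9 : signalFraction ϑ p * (1 / 2) ≤
                signalFraction ϑ p * (1 - maxRowNonzeros (Ω p) * signalFraction ϑ p) := by gcongr
            exact mul_le_mul_of_nonneg_left
              (mul_le_mul h9 hgap h8 (le_trans (by positivity) h9)) hp0.le
    have hpu : p * twoSidedPValue t ≤ 2 * (p : ℝ) ^ (1 - q) := by
      have e : (p : ℝ) ^ (1 - q) = p * (p : ℝ) ^ (-q) := by
        rw [sub_eq_add_neg, Real.rpow_add hp0, Real.rpow_one]
      rw [e]
      nlinarith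
    have hpu0 : 0 < p * twoSidedPValue t := mul_pos hp0 hu0
    -- comparison of the critical value with the lower bound for Higher Criticism
    have hv1 : maxRowNonzeros (Ω p) * criticalValue p (α p) ≤
        Δ / (2 * √(p * twoSidedPValue t)) := by
      have e1 : (p : ℝ) ^ (-b) * (p : ℝ) ^ b = 1 := by
        rw [← Real.rpow_add hp0]; simp
      have hle : maxRowNonzeros (Ω p) * criticalValue p (α p) ≤ C' / 4 * (p : ℝ) ^ b := by
        have := mul_le_mul_of_nonneg_right h4.le (by positivity : (0 : ℝ) ≤ (p : ℝ) ^ b)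
        rwa [mul_assoc, e1, mul_one] at this
      refine hle.trans ?_
      have hs : √(p * twoSidedPValue t) ≤ 2 * (p : ℝ) ^ ((1 - q) / 2) := by
        refine Real.sqrt_le_iff.2 ⟨by positivity, hpu.trans ?_⟩
        have e2 : ((p : ℝ) ^ ((1 - q) / 2)) ^ 2 = (p : ℝ) ^ (1 - q) := by
          rw [← Real.rpow_natCast, ← Real.rpow_mul hp0.le]; congr 1; push_cast; ring
        have : 0 ≤ (p : ℝ) ^ (1 - q) := by positivity
        rw [mul_pow, e2]
        linarith
      rw [le_div_iff₀ (by positivity)]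
      have e3 : (p : ℝ) ^ b * (p : ℝ) ^ ((1 - q) / 2) = (p : ℝ) ^ a := by
        rw [← Real.rpow_add hp0]; congr 1; simp only [a, b, γ]; ring
      calc C' / 4 * (p : ℝ) ^ b * (2 * √(p * twoSidedPValue t))
          ≤ C' / 4 * (p : ℝ) ^ b * (2 * (2 * (p : ℝ) ^ ((1 - q) / 2))) := by gcongr
        _ = C' * ((p : ℝ) ^ b * (p : ℝ) ^ ((1 - q) / 2)) := by ring
        _ = Δ := by rw [e3]
    have hv2 : maxRowNonzeros (Ω p) * criticalValue p (α p) ≤ √p / 4 := by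
      have e1 : (p : ℝ) ^ (-(1 / 2 : ℝ)) * √p = 1 := by
        rw [Real.sqrt_eq_rpow, ← Real.rpow_add hp0]; simp
      have := mul_le_mul_of_nonneg_right h5.le (Real.sqrt_nonneg (p : ℝ))
      rw [mul_assoc, e1, mul_one] at this
      linarith
    have hmain := le_altLaw_innovatedHC hp (hΩ.posDef p) (hΩ.diag p) hε (Real.sqrt_nonneg _)
      (by linarith) hΔ0 hΔ hv1 hv2
    refine le_trans ?_ hmain
    have e4 : ((p : ℝ) ^ (-b)) ^ 2 = (p : ℝ) ^ (1 - q) / ((p : ℝ) ^ a) ^ 2 := by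
      rw [← Real.rpow_natCast, ← Real.rpow_natCast, ← Real.rpow_mul hp0.le,
        ← Real.rpow_mul hp0.le, ← Real.rpow_sub hp0]
      congr 1; simp only [a, b, γ]; push_cast; ring
    have e5 : ((p : ℝ) ^ (-(a / 2))) ^ 2 = 1 / (p : ℝ) ^ a := by
      rw [← Real.rpow_natCast, ← Real.rpow_mul hp0.le, one_div, ← Real.rpow_neg hp0.le]
      congr 1; push_cast; ring
    have e6 : 8 / C' ^ 2 * ((maxRowNonzeros (Ω p) : ℝ) * (p : ℝ) ^ (-b)) ^ 2 +
        4 / C' * ((maxRowNonzeros (Ω p) : ℝ) * (p : ℝ) ^ (-(a / 2))) ^ 2 =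
        4 * (maxRowNonzeros (Ω p) : ℝ) ^ 2 * (2 * (p : ℝ) ^ (1 - q) / Δ ^ 2 + 1 / Δ) := by
      rw [mul_pow, mul_pow, e4, e5]
      have : (p : ℝ) ^ a ≠ 0 := by positivity
      simp only [Δ]
      field_simp
      ring
    rw [e6]
    gcongr
  have hlim : Tendsto (fun p : ℕ => 1 - (8 / C' ^ 2 *
      ((maxRowNonzeros (Ω p) : ℝ) * (p : ℝ) ^ (-b)) ^ 2 +
      4 / C' * ((maxRowNonzeros (Ω p) : ℝ) * (p : ℝ) ^ (-(a / 2))) ^ 2)) atTop (𝓝 1) := by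
    have := (((hΩ.sparse b hb).pow 2).const_mul (8 / C' ^ 2)).add
      (((hΩ.sparse (a / 2) (half_pos ha)).pow 2).const_mul (4 / C'))
    simpa using this.const_sub 1
  refine tendsto_of_tendsto_of_tendsto_of_le_of_le' hlim tendsto_const_nhds hbound ?_
  filter_upwards [eventually_ge_atTop 2] with p hp
  have := isProbabilityMeasure_altLaw r (Ω p) (signalFraction_mem_Icc hϑ0 hp)
  exact measureReal_le_one

end ARW

theorem mainTheorem1 (ϑ r : ℝ) (hϑ0 : 0 < ϑ) (hϑ1 : ϑ < 1) (hr : 0 < r)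
    (Ω : ∀ p : ℕ, Matrix (Fin p) (Fin p) ℝ) (hΩ : ARW.IsSparsePrecision Ω) :
    (ARW.phaseFunction ϑ < r →
      ∀ α : ℕ → ℝ, ARW.TendsToZeroSlowly α →
        Tendsto (fun p : ℕ => ARW.ihcPower ϑ r (Ω p) (α p)) atTop (𝓝 1)) ∧
    (r < ARW.phaseFunction ϑ →
      ∀ φ : ∀ p : ℕ, EuclideanSpace ℝ (Fin p) → ℝ, (∀ p, ARW.IsTest (φ p)) →
        Tendsto (fun p : ℕ => ARW.typeIError (Ω p) (φ p) + ARW.typeIIError ϑ r (Ω p) (φ p))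
          atTop (𝓝 1)) :=
  ⟨fun h _ hα => ARW.tendsto_ihcPower hϑ0 hϑ1 hr hΩ h hα,
    fun h _ hφ => ARW.tendsto_typeIError_add_typeIIError hϑ0 hϑ1 hr hΩ h hφ⟩
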